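/- For $n,p\in\mathbb N$, a real $n\times p$ matrix $X$ with rows $X_i^T$, $Y\in\{0,1\}^n$, $v\in\mathbb R^p$ and a positive definite matrix $Q\in\mathbb R^{p\times p}$, put $\Sigma = X^TX+Q$. The Albert--Chib chain for the Bayesian probit model with prior $\mathrm N_p(v,Q^{-1})$ moves from $\beta\in\mathbb R^p$ as follows: draw independent $Z_i$, $i=1,\dots,n$, from $\mathrm N(X_i^T\beta,1)$ truncated to $(0,\infty)$ if $Y_i=1$ and to $(-\infty,0)$ if $Y_i=0$; then draw the new state from $\mathrm N_p\big(\Sigma^{-1}(X^TZ+Qv),\Sigma^{-1}\big)$. Let $K$ be its transition kernel and let $\Pi$ be the posterior distribution, with density proportional to $$\prod_{i=1}^n \Phi(X_i^T\beta)^{Y_i}\,(1-\Phi(X_i^T\beta))^{1-Y_i}\; e^{-\frac12(\beta-v)^TQ(\beta-v)} .$$ The $L^2$-geometric convergence rate $\rho_{**}$ is the infimum of all $\rho\in[0,1]$ such that for every probability measure $\nu\ll\Pi$ with $\int (d\nu/d\Pi)^2\,d\Pi<\infty$ there is $M_\nu<\infty$ with $\|\nu K^m-\Pi\|_{TV}\le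 M_\nu\rho^m$ for all $m$. **Proposition.** Take $n=1$ and $v=0$, and write $\psi = X\Sigma^{-1}X^T$. (1) As $\psi\to1$, $1-\rho_{**}=O(1-\psi)$, uniformly in the model: there are constants $C,\delta>0$ such that for all $p$, $X\in\mathbb R^{1\times p}$, $Y\in\{0,1\}$ and positive definite $Q\in\mathbb R^{p\times p}$ with $|\psi-1|<\delta$ one has $|1-\rho_{**}|\le C\,|1-\psi|$. (2) Let $Y\in\{0,1\}$ be fixed and for each $p\ge1$ let $X_p\in\mathbb R^{1\times p}$ and let $Q_p\in\mathbb R^{p\times p}$ be positive definite. Suppose the following condition fails: (B2) there is a finite constant $c>0$ with $\lambda_{\max}(X_pQ_p^{-1}X_p^T)<c$ for all $p\ge1$. Then $\rho_{**}$ is not bounded away from $1$: there is no $\rho<1$ such that the rate $\rho_{**}$ of the chain with data $X_p,Y,Q_p$ and $v=0$ is at most $\rho$ for all $p\ge1$. -/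

import Mathlib

open MeasureTheory ProbabilityTheory Matrix
open scoped ENNReal

noncomputable section

open scoped MatrixOrder

/-! ### The `L²`-geometric convergence rate of a Markov chain -/

/-- Total variation distance of two finite measures: `sup_A |μ(A) - ν(A)|` over measurable `A`.
(The total variation norm of `μ - ν`, for probability measures, is twice this; the factor is
absorbed by the constant `M` below and does not affect convergence rates.) -/
def tvDist {S : Type*} [MeasurableSpace S] (μ ν : Measure S) : ℝ :=
  ⨆ A : {A : Set S // MeasurableSet A}, |μ.real A - ν.real A|

/-- `ν` is absolutely continuous with respect to `π` with square-integrable density. -/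
def InL2 {S : Type*} [MeasurableSpace S] (π ν : Measure S) : Prop :=
  ν ≪ π ∧ ∫⁻ x, (ν.rnDeriv π x) ^ 2 ∂π < ∞

/-- For every probability measure `ν ∈ L²(π)` there is a finite `M` with
`‖ν Kᵐ - π‖_TV ≤ M ρᵐ` for all `m`. Here `(K ^ m) ∘ₘ ν` is the measure `∫ Kᵐ(x, ·) ν(dx)`. -/
def IsL2GeometricRate {S : Type*} [MeasurableSpace S] (K : Kernel S S) (π : Measure S)
    (ρ : ℝ) : Prop :=
  ∀ ν : Measure S, IsProbabilityMeasure ν → InL2 π ν →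
    ∃ M : ℝ, ∀ m : ℕ, tvDist ((K ^ m) ∘ₘ ν) π ≤ M * ρ ^ m

/-- The `L²`-geometric convergence rate `ρ_**` of the chain with transition kernel `K` and
invariant law `π`. -/
def l2Rate {S : Type*} [MeasurableSpace S] (K : Kernel S S) (π : Measure S) : ℝ :=
  sInf {ρ : ℝ | ρ ∈ Set.Icc (0 : ℝ) 1 ∧ IsL2GeometricRate K π ρ}

/-! ### Bayesian probit regression and the Albert-Chib chain

Data: `n × p` design matrix `X`, binary responses `Y` (`true` is `1`, `false` is `0`),
prior precision `Q` and prior mean `v`. -/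

/-- Standard normal distribution function. -/
def stdNormalCDF (x : ℝ) : ℝ := cdf (gaussianReal 0 1) x

/-- Unnormalised posterior density
`∏ᵢ Φ(Xᵢᵀβ)^{Yᵢ} (1 - Φ(Xᵢᵀβ))^{1 - Yᵢ} · exp(-(β - v)ᵀ Q (β - v) / 2)`. -/
def posteriorWeight {n p : ℕ} (X : Matrix (Fin n) (Fin p) ℝ) (Y : Fin n → Bool)
    (Q : Matrix (Fin p) (Fin p) ℝ) (v : Fin p → ℝ) (β : EuclideanSpace ℝ (Fin p)) : ℝ :=
  (∏ i, if Y i then stdNormalCDF ((X *ᵥ β.ofLp) i) else 1 - stdNormalCDF ((X *ᵥ β.ofLp) i)) *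
    Real.exp (-(1 / 2) * ((β.ofLp - v) ⬝ᵥ (Q *ᵥ (β.ofLp - v))))

/-- The posterior distribution of the regression coefficients. -/
def posterior {n p : ℕ} (X : Matrix (Fin n) (Fin p) ℝ) (Y : Fin n → Bool)
    (Q : Matrix (Fin p) (Fin p) ℝ) (v : Fin p → ℝ) : Measure (EuclideanSpace ℝ (Fin p)) :=
  (∫⁻ β, ENNReal.ofReal (posteriorWeight X Y Q v β))⁻¹ •
    volume.withDensity (fun β => ENNReal.ofReal (posteriorWeight X Y Q v β))

/-- `(0, ∞)` for response `1`, `(-∞, 0)` for response `0`. -/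
def truncationSet (y : Bool) : Set ℝ := if y then Set.Ioi 0 else Set.Iio 0

/-- `TN(θ, 1; y)`: the `N(θ, 1)` law conditioned on `truncationSet y`. -/
def truncNormal (θ : ℝ) (y : Bool) : Measure ℝ := (gaussianReal θ 1)[|truncationSet y]

/-- `Σ = XᵀX + Q`. -/
def sigmaMat {n p : ℕ} (X : Matrix (Fin n) (Fin p) ℝ) (Q : Matrix (Fin p) (Fin p) ℝ) :
    Matrix (Fin p) (Fin p) ℝ :=
  Xᵀ * X + Q

theorem measurableSet_truncationSet (y : Bool) : MeasurableSet (truncationSet y) := by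
  unfold truncationSet; split
  · exact measurableSet_Ioi
  · exact measurableSet_Iio

theorem gaussianReal_truncationSet_ne_zero (θ : ℝ) (y : Bool) :
    gaussianReal θ 1 (truncationSet y) ≠ 0 := by
  intro h
  have h2 := gaussianReal_absolutelyContinuous' θ (v := 1) one_ne_zero h
  unfold truncationSet at h2
  split at h2 <;> simp at h2

instance isProbabilityMeasure_truncNormal (θ : ℝ) (y : Bool) :
    IsProbabilityMeasure (truncNormal θ y) :=
  cond_isProbabilityMeasure (gaussianReal_truncationSet_ne_zero θ y)

theorem measurable_gaussianReal_mean {s : Set ℝ} (hs : MeasurableSet s) :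
    Measurable (fun θ : ℝ => gaussianReal θ 1 s) := by
  have h : ∀ θ : ℝ, gaussianReal θ 1 s = gaussianReal 0 1 (Prod.mk θ ⁻¹' {q | q.1 + q.2 ∈ s}) := by
    intro θ
    have := gaussianReal_map_const_add (μ := 0) (v := 1) θ
    rw [zero_add] at this
    rw [← this, Measure.map_apply (by fun_prop) hs]
    rfl
  simp_rw [h]
  exact measurable_measure_prodMk_left (measurableSet_preimage (by fun_prop) hs)

theorem measurable_truncNormal (y : Bool) : Measurable (fun θ : ℝ => truncNormal θ y) := by
  refine Measure.measurable_of_measurable_coe _ fun s hs => ?_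
  simp only [truncNormal, cond_apply (measurableSet_truncationSet y)]
  exact (measurable_gaussianReal_mean (measurableSet_truncationSet y)).inv.mul
    (measurable_gaussianReal_mean ((measurableSet_truncationSet y).inter hs))

/-- First step: given `β`, draw independent `Zᵢ ∼ TN(Xᵢᵀβ, 1; Yᵢ)`. -/
def latentKernel {n p : ℕ} (X : Matrix (Fin n) (Fin p) ℝ) (Y : Fin n → Bool) :
    Kernel (EuclideanSpace ℝ (Fin p)) (Fin n → ℝ) where
  toFun β := Measure.pi fun i => truncNormal ((X *ᵥ β.ofLp) i) (Y i)
  measurable' := by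
    refine Measurable.measure_of_isPiSystem_of_isProbabilityMeasure generateFrom_pi.symm
      isPiSystem_pi ?_
    rintro _ ⟨t, ht, rfl⟩
    simp_rw [Measure.pi_pi]
    refine Finset.measurable_prod _ fun i _ => ?_
    have h1 : Measurable fun β : EuclideanSpace ℝ (Fin p) => (X *ᵥ β.ofLp) i := by
      simp only [mulVec, dotProduct]; fun_prop
    exact (Measure.measurable_coe (show MeasurableSet (t i) from ht i (Set.mem_univ i))).comp
      ((measurable_truncNormal (Y i)).comp h1)

/-- Second step: given `z`, draw `β ∼ N_p(Σ⁻¹(Xᵀz + Qv), Σ⁻¹)`. -/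
def coefKernel {n p : ℕ} (X : Matrix (Fin n) (Fin p) ℝ) (Q : Matrix (Fin p) (Fin p) ℝ)
    (v : Fin p → ℝ) : Kernel (Fin n → ℝ) (EuclideanSpace ℝ (Fin p)) where
  toFun z := multivariateGaussian
    (WithLp.toLp 2 ((sigmaMat X Q)⁻¹ *ᵥ (Xᵀ *ᵥ z + Q *ᵥ v))) (sigmaMat X Q)⁻¹
  measurable' := by
    refine Measure.measurable_of_measurable_coe _ fun s hs => ?_
    have hm : Measurable fun z : Fin n → ℝ =>
        WithLp.toLp 2 ((sigmaMat X Q)⁻¹ *ᵥ (Xᵀ *ᵥ z + Q *ᵥ v)) := by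
      have : Continuous fun z : Fin n → ℝ => (sigmaMat X Q)⁻¹ *ᵥ (Xᵀ *ᵥ z + Q *ᵥ v) := by
        fun_prop
      exact ((PiLp.continuous_toLp 2 _).comp this).measurable
    have h : ∀ z : Fin n → ℝ, multivariateGaussian
        (WithLp.toLp 2 ((sigmaMat X Q)⁻¹ *ᵥ (Xᵀ *ᵥ z + Q *ᵥ v))) (sigmaMat X Q)⁻¹ s =
        stdGaussian (EuclideanSpace ℝ (Fin p)) (Prod.mk z ⁻¹'
          {q | WithLp.toLp 2 ((sigmaMat X Q)⁻¹ *ᵥ (Xᵀ *ᵥ q.1 + Q *ᵥ v)) +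
            toEuclideanCLM (𝕜 := ℝ) (CFC.sqrt (sigmaMat X Q)⁻¹) q.2 ∈ s}) := by
      intro z
      rw [multivariateGaussian, Measure.map_apply (by fun_prop) hs]
      rfl
    simp_rw [h]
    exact measurable_measure_prodMk_left (measurableSet_preimage
      ((hm.comp measurable_fst).add (by fun_prop)) hs)

/-- Transition kernel of the Albert-Chib data augmentation chain: from `β`, draw the latent `z`
and then the new coefficient vector. -/
def acKernel {n p : ℕ} (X : Matrix (Fin n) (Fin p) ℝ) (Y : Fin n → Bool)
    (Q : Matrix (Fin p) (Fin p) ℝ) (v : Fin p → ℝ) :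
    Kernel (EuclideanSpace ℝ (Fin p)) (EuclideanSpace ℝ (Fin p)) :=
  coefKernel X Q v ∘ₖ latentKernel X Y

/-- The rate `ρ_**` of the Albert-Chib chain. -/
def acL2Rate {n p : ℕ} (X : Matrix (Fin n) (Fin p) ℝ) (Y : Fin n → Bool)
    (Q : Matrix (Fin p) (Fin p) ℝ) (v : Fin p → ℝ) : ℝ :=
  l2Rate (acKernel X Y Q v) (posterior X Y Q v)

/-- `X Σ⁻¹ Xᵀ` for a single observation, where it is a `1 × 1` matrix, i.e. a number. -/
def psi {p : ℕ} (X : Matrix (Fin 1) (Fin p) ℝ) (Q : Matrix (Fin p) (Fin p) ℝ) : ℝ :=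
  (X * (sigmaMat X Q)⁻¹ * Xᵀ) 0 0

/-- Largest eigenvalue of a real symmetric matrix. -/
def lambdaMax {n : ℕ} (M : Matrix (Fin n) (Fin n) ℝ) : ℝ := sSup (spectrum ℝ M)

/-- (B2), for a sequence of design matrices and prior precisions indexed by the dimension `p ≥ 1`:
`λ_max(X Q⁻¹ Xᵀ) < c` for all `p` with one finite positive constant `c`. -/
def AssumptionB2 {n : ℕ} (X : (p : ℕ) → Matrix (Fin n) (Fin p) ℝ)
    (Q : (p : ℕ) → Matrix (Fin p) (Fin p) ℝ) : Prop :=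
  ∃ c : ℝ, 0 < c ∧ ∀ p : ℕ, 1 ≤ p → lambdaMax (X p * (Q p)⁻¹ * (X p)ᵀ) < c

end

noncomputable section

open scoped MatrixOrder

/-! ### Total variation and bounded functions -/

section TotalVariation

variable {S : Type*} [MeasurableSpace S]

/-! The chain alternates between the two conditionals of one joint law of `(β, z)`, so its averaging
operator is symmetric in `L²(Π)` (`kernelSymmetric_comp`). For a symmetric operator every Rayleigh
quotient of a bounded centred function bounds each `L²`-geometric rate from below
(`integral_mul_kernelMean_le_rate_mul`), so one slowly mixing observable suffices.

The observable is `cos (r Xβ)`. Completing the square shows that, in stationarity, `z` is `N(0,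
1/(1-ψ))` restricted to a half-line and that, given `z`, `Xβ` is `N(ψz, ψ)`. Averaging the cosine
over `β` gives a multiple of a cosine in `z`; this is even, so the restriction to a half-line does
not affect its integral and the response drops out. All moments needed are values of Gaussian
characteristic functions (`posterior_compProd_latentKernel`, `integral_cond_truncationSet_of_even`,
`kernelMean_coefKernel_cos`).

With `r² = 1-ψ` the variance of the observable stays bounded below while one step loses covariance
only of order `1-ψ`. Hence the rate is at least `1 - 9(1-ψ)` when `ψ ≥ 1/2` (`one_sub_le_acL2Rate`).
For the second claim, `1-ψ = 1/(1+t)` with `t = XQ⁻¹Xᵀ`, so unbounded `t` forces rates arbitrarily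
close to `1`. -/

theorem abs_measureReal_sub_le_tvDist {μ ν : Measure S} [IsProbabilityMeasure μ]
    [IsProbabilityMeasure ν] {A : Set S} (hA : MeasurableSet A) :
    |μ.real A - ν.real A| ≤ tvDist μ ν := by
  refine le_ciSup (f := fun A : {A : Set S // MeasurableSet A} => |μ.real A - ν.real A|)
    ⟨1, ?_⟩ ⟨A, hA⟩
  rintro _ ⟨B, rfl⟩
  have h1 : μ.real B.1 ≤ 1 := measureReal_le_one
  have h2 : ν.real B.1 ≤ 1 := measureReal_le_one
  have h3 : 0 ≤ μ.real B.1 := measureReal_nonneg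
  have h4 : 0 ≤ ν.real B.1 := measureReal_nonneg
  exact abs_le.2 ⟨by linarith, by linarith⟩

theorem tvDist_le_one (μ ν : Measure S) [IsProbabilityMeasure μ] [IsProbabilityMeasure ν] :
    tvDist μ ν ≤ 1 := by
  have : Nonempty {A : Set S // MeasurableSet A} := ⟨⟨∅, .empty⟩⟩
  refine ciSup_le fun B => ?_
  have h1 : μ.real B.1 ≤ 1 := measureReal_le_one
  have h2 : ν.real B.1 ≤ 1 := measureReal_le_one
  have h3 : 0 ≤ μ.real B.1 := measureReal_nonneg
  have h4 : 0 ≤ ν.real B.1 := measureReal_nonneg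
  exact abs_le.2 ⟨by linarith, by linarith⟩

theorem integrable_of_bounded {μ : Measure S} [IsFiniteMeasure μ] {f : S → ℝ}
    (hf : Measurable f) {B : ℝ} (hB : ∀ x, |f x| ≤ B) : Integrable f μ :=
  .of_bound hf.aestronglyMeasurable B (.of_forall hB)

/-- Layer cake: `f + 1` takes values in `[0, 2]`, so its integral is the integral over levels in
`(0, 2]` of the superlevel measures, and at each level these differ by at most `tvDist μ ν`. -/
theorem integral_sub_integral_le_tvDist {μ ν : Measure S} [IsProbabilityMeasure μ]
    [IsProbabilityMeasure ν] {f : S → ℝ} (hf : Measurable f) (hB : ∀ x, |f x| ≤ 1) :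
    ∫ x, f x ∂μ - ∫ x, f x ∂ν ≤ 2 * tvDist μ ν := by
  have hg : Measurable fun x => f x + 1 := hf.add_const 1
  have h0 : ∀ x, 0 ≤ f x + 1 := fun x => by linarith [(abs_le.1 (hB x)).1]
  have h2 : ∀ x, f x + 1 ≤ 2 := fun x => by linarith [(abs_le.1 (hB x)).2]
  have key : ∀ (ρ : Measure S) [IsProbabilityMeasure ρ], ∫ x, f x ∂ρ + 1 =
      ∫ t in Set.Ioc (0 : ℝ) 2, ρ.real {a | t ≤ f a + 1} := by
    intro ρ _
    have hi : Integrable f ρ := integrable_of_bounded hf hB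
    have h := Integrable.integral_eq_integral_Ioc_meas_le (μ := ρ) (f := fun x => f x + 1)
      (hi.add (integrable_const 1)) (.of_forall h0) (.of_forall h2)
    rw [← h, integral_add hi (integrable_const 1)]
    simp
  have hint : ∀ (ρ : Measure S) [IsProbabilityMeasure ρ],
      IntegrableOn (fun t : ℝ => ρ.real {a | t ≤ f a + 1}) (Set.Ioc 0 2) := by
    intro ρ _
    refine Measure.integrableOn_of_bounded (M := 1) (by simp) ?_ (.of_forall fun t => ?_)
    · have : Antitone fun t : ℝ => ρ.real {a | t ≤ f a + 1} := fun s t hst =>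
        measureReal_mono (fun a (ha : t ≤ f a + 1) => le_trans hst ha) (measure_ne_top _ _)
      exact this.measurable.aestronglyMeasurable
    · rw [Real.norm_eq_abs, abs_of_nonneg measureReal_nonneg]; exact measureReal_le_one
  have : ∫ x, f x ∂μ - ∫ x, f x ∂ν = ∫ t in Set.Ioc (0 : ℝ) 2,
      (μ.real {a | t ≤ f a + 1} - ν.real {a | t ≤ f a + 1}) := by
    rw [integral_sub (hint μ) (hint ν), ← key μ, ← key ν]; ring
  rw [this]
  calc _ ≤ ∫ t in Set.Ioc (0 : ℝ) 2, tvDist μ ν := by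
        refine integral_mono ((hint μ).sub (hint ν)) (by simp) fun t => ?_
        exact (le_abs_self _).trans (abs_measureReal_sub_le_tvDist
          (measurableSet_le measurable_const hg))
    _ = _ := by simp

end TotalVariation

/-! ### Averaging operators of Markov kernels -/

section KernelMean

variable {S T U : Type*} [MeasurableSpace S] [MeasurableSpace T] [MeasurableSpace U]

/-- The averaging operator `f ↦ ∫ f(y) κ(·, dy)` of a kernel. -/
def kernelMean (κ : Kernel S T) (f : T → ℝ) (x : S) : ℝ := ∫ y, f y ∂κ x

variable {f : T → ℝ} {B : ℝ}

theorem measurable_kernelMean (κ : Kernel S T) [IsSFiniteKernel κ] (hf : Measurable f) :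
    Measurable (kernelMean κ f) :=
  (StronglyMeasurable.integral_kernel hf.stronglyMeasurable).measurable

theorem abs_kernelMean_le (κ : Kernel S T) [IsMarkovKernel κ] (hB : ∀ y, |f y| ≤ B) (x : S) :
    |kernelMean κ f x| ≤ B := by
  simpa [kernelMean] using norm_integral_le_of_norm_le_const (μ := κ x) (f := f) (C := B) (.of_forall hB)

theorem kernelMean_comp (η : Kernel U T) [IsMarkovKernel η] (κ : Kernel S U) [IsMarkovKernel κ]
    (hf : Measurable f) (hB : ∀ y, |f y| ≤ B) :
    kernelMean (η ∘ₖ κ) f = kernelMean κ (kernelMean η f) := by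
  funext x
  exact Kernel.integral_comp (integrable_of_bounded hf hB)

theorem integral_kernel_comp_measure (κ : Kernel S T) [IsMarkovKernel κ] (μ : Measure S)
    [IsProbabilityMeasure μ] (hf : Measurable f) (hB : ∀ y, |f y| ≤ B) :
    ∫ y, f y ∂(κ ∘ₘ μ) = ∫ x, kernelMean κ f x ∂μ := by
  rw [Measure.comp_eq_comp_const_apply]
  exact (Kernel.integral_comp (integrable_of_bounded hf hB)).trans (by simp [kernelMean])

end KernelMean

/-! ### Rayleigh quotients bound the `L²`-geometric rate from below -/

section Rayleigh

variable {S : Type*} [MeasurableSpace S]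

theorem isMarkovKernel_pow (K : Kernel S S) [IsMarkovKernel K] (m : ℕ) :
    IsMarkovKernel (K ^ m) := by
  induction m with
  | zero => rw [pow_zero]; exact inferInstanceAs (IsMarkovKernel (Kernel.id : Kernel S S))
  | succ m ih => rw [pow_succ]; exact inferInstanceAs (IsMarkovKernel ((K ^ m) ∘ₖ K))

/-- The averaging operator of `K` is symmetric on bounded functions in `L²(π)`. -/
def KernelSymmetric (K : Kernel S S) (π : Measure S) : Prop :=
  ∀ (f g : S → ℝ) (B : ℝ), Measurable f → Measurable g → (∀ x, |f x| ≤ B) → (∀ x, |g x| ≤ B) →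
    ∫ x, f x * kernelMean K g x ∂π = ∫ x, kernelMean K f x * g x ∂π

variable {K : Kernel S S} [IsMarkovKernel K] {π : Measure S} {f : S → ℝ}

theorem kernelMean_pow_add (m n : ℕ) {B : ℝ} (hf : Measurable f) (hB : ∀ x, |f x| ≤ B) :
    kernelMean (K ^ (m + n)) f = kernelMean (K ^ n) (kernelMean (K ^ m) f) := by
  have := isMarkovKernel_pow K m
  have := isMarkovKernel_pow K n
  rw [pow_add]
  exact kernelMean_comp _ _ hf hB

theorem KernelSymmetric.pow (h : KernelSymmetric K π) (m : ℕ) : KernelSymmetric (K ^ m) π := by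
  induction m with
  | zero =>
    intro f g B hf hg hBf hBg
    have : ∀ {g : S → ℝ}, Measurable g → kernelMean (K ^ 0) g = g := by
      intro g hg
      funext x
      exact (integral_dirac' g x hg.stronglyMeasurable)
    rw [this hf, this hg]
  | succ m ih =>
    intro f g B hf hg hBf hBg
    have := isMarkovKernel_pow K m
    rw [kernelMean_pow_add m 1 hg hBg, add_comm m 1, kernelMean_pow_add 1 m hf hBf, pow_one,
      h f _ B hf (measurable_kernelMean _ hg) hBf (abs_kernelMean_le _ hBg),
      ih _ g B (measurable_kernelMean _ hf) hg (abs_kernelMean_le _ hBf) hBg]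

theorem KernelSymmetric.integral_kernelMean (h : KernelSymmetric K π) {B : ℝ} (hf : Measurable f)
    (hB : ∀ x, |f x| ≤ B) : ∫ x, kernelMean K f x ∂π = ∫ x, f x ∂π := by
  -- Symmetry tested against the constant `1`, which the kernel preserves; `max 1 B` is a common
  -- bound for both functions.
  have := h (fun _ => 1) f (max 1 B) measurable_const hf (by simp)
    fun x => (hB x).trans (le_max_right _ _)
  simpa [kernelMean] using this

variable [IsProbabilityMeasure π]

/-- Cauchy-Schwarz for bounded functions. -/
theorem integral_mul_sq_le {f g : S → ℝ} {B : ℝ} (hf : Measurable f) (hg : Measurable g)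
    (hBf : ∀ x, |f x| ≤ B) (hBg : ∀ x, |g x| ≤ B) :
    (∫ x, f x * g x ∂π) ^ 2 ≤ (∫ x, f x ^ 2 ∂π) * ∫ x, g x ^ 2 ∂π := by
  have hi : ∀ {f g : S → ℝ}, Measurable f → Measurable g → (∀ x, |f x| ≤ B) → (∀ x, |g x| ≤ B) →
      Integrable (fun x => f x * g x) π := by
    intro f g hf hg hBf hBg
    refine integrable_of_bounded (hf.mul hg) (B := B * B) fun x => ?_
    rw [abs_mul]
    exact mul_le_mul (hBf x) (hBg x) (abs_nonneg _) ((abs_nonneg _).trans (hBf x))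
  have hff := hi hf hf hBf hBf
  have hgg := hi hg hg hBg hBg
  have hfg := hi hf hg hBf hBg
  -- The quadratic `t ↦ ∫ (t f + g)²` is nonnegative, so its discriminant is at most `0`.
  have hq : ∀ t : ℝ, 0 ≤ (∫ x, f x ^ 2 ∂π) * (t * t) + (2 * ∫ x, f x * g x ∂π) * t +
      ∫ x, g x ^ 2 ∂π := by
    intro t
    have h0 : 0 ≤ ∫ x, (t * f x + g x) ^ 2 ∂π := integral_nonneg fun x => sq_nonneg _
    have h1 : ∀ x, (t * f x + g x) ^ 2 =
        t * t * (f x * f x) + 2 * t * (f x * g x) + g x * g x := fun x => by ring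
    simp_rw [h1] at h0
    rw [integral_add (f := fun x => t * t * (f x * f x) + 2 * t * (f x * g x))
      ((hff.const_mul _).add (hfg.const_mul _)) hgg,
      integral_add (hff.const_mul _) (hfg.const_mul _), integral_const_mul,
      integral_const_mul] at h0
    simp_rw [pow_two]
    linarith
  have := discrim_le_zero hq
  rw [discrim] at this
  nlinarith

theorem InL2.of_density {g : S → ℝ} (hg : Measurable g) (h2 : ∀ x, g x ≤ 2) :
    InL2 π (π.withDensity fun x => ENNReal.ofReal (g x)) := by
  refine ⟨withDensity_absolutelyContinuous _ _, ?_⟩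
  have h := Measure.rnDeriv_withDensity π (hg.ennreal_ofReal)
  calc _ ≤ ∫⁻ _, (2 : ℝ≥0∞) ^ 2 ∂π := by
        refine lintegral_mono_ae ?_
        filter_upwards [h] with x hx
        rw [hx]
        gcongr
        exact (ENNReal.ofReal_le_ofReal (h2 x)).trans (by simp)
    _ < ∞ := by simp

/-- The autocovariances of a bounded observable decay at any `L²`-geometric rate. -/
theorem exists_integral_mul_kernelMean_pow_le (hK : KernelSymmetric K π) (hf : Measurable f)
    (hB : ∀ x, |f x| ≤ 1) (h0 : ∫ x, f x ∂π = 0) {ρ : ℝ} (hρ : IsL2GeometricRate K π ρ) :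
    ∃ M : ℝ, ∀ m : ℕ, ∫ x, f x * kernelMean (K ^ m) f x ∂π ≤ M * ρ ^ m := by
  have hfi : Integrable f π := integrable_of_bounded hf hB
  have hnn : ∀ x, 0 ≤ 1 + f x := fun x => by linarith [(abs_le.1 (hB x)).1]
  have hle : ∀ x, 1 + f x ≤ 2 := fun x => by linarith [(abs_le.1 (hB x)).2]
  have hm1 : Measurable fun x => 1 + f x := hf.const_add 1
  -- Starting from the density `1 + f`, the mean of `f` after `m` steps is `∫ (1 + f) Kᵐf dπ`.
  -- Invariance and centring remove the first term and leave the autocovariance.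
  set ν := π.withDensity fun x => ENNReal.ofReal (1 + f x) with hν
  have : IsProbabilityMeasure ν := by
    constructor
    rw [hν, withDensity_apply _ .univ, Measure.restrict_univ,
      ← ofReal_integral_eq_lintegral_ofReal (f := fun x => 1 + f x)
        ((integrable_const 1).add hfi) (.of_forall hnn),
      integral_add (integrable_const 1) hfi, h0]
    simp
  obtain ⟨M, hM⟩ := hρ ν inferInstance (.of_density hm1 hle)
  refine ⟨2 * M, fun m => ?_⟩
  have := isMarkovKernel_pow K m
  have hTm := measurable_kernelMean (K ^ m) hf
  have hTB := abs_kernelMean_le (K ^ m) hB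
  have hTi : Integrable (kernelMean (K ^ m) f) π := integrable_of_bounded hTm hTB
  have h := (integral_sub_integral_le_tvDist (μ := (K ^ m) ∘ₘ ν) (ν := π) hf hB).trans
    (mul_le_mul_of_nonneg_left (hM m) zero_le_two)
  rw [h0, sub_zero, integral_kernel_comp_measure (K ^ m) ν hf hB, hν,
    integral_withDensity_eq_integral_toReal_smul hm1.ennreal_ofReal (by simp)] at h
  simp_rw [ENNReal.toReal_ofReal (hnn _), smul_eq_mul, add_mul, one_mul] at h
  rw [integral_add hTi, (hK.pow m).integral_kernelMean hf hB, h0, zero_add] at h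
  · linarith
  · refine integrable_of_bounded (hf.mul hTm) (B := 1) fun x => ?_
    rw [abs_mul]
    exact mul_le_one₀ (hB x) (abs_nonneg _) (hTB x)

/-- By symmetry `∫ f K²ᵐf = ∫ (Kᵐf)²`, so this is Cauchy-Schwarz. It yields growth along powers of
two without the spectral theorem. -/
theorem sq_integral_mul_kernelMean_pow_le (hK : KernelSymmetric K π) (hf : Measurable f)
    (hB : ∀ x, |f x| ≤ 1) (m : ℕ) :
    (∫ x, f x * kernelMean (K ^ m) f x ∂π) ^ 2 ≤
      (∫ x, f x ^ 2 ∂π) * ∫ x, f x * kernelMean (K ^ (m + m)) f x ∂π := by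
  have := isMarkovKernel_pow K m
  have hTm := measurable_kernelMean (K ^ m) hf
  have hTB := abs_kernelMean_le (K ^ m) hB
  rw [kernelMean_pow_add m m hf hB, (hK.pow m) f _ 1 hf hTm hB hTB]
  simp_rw [← pow_two]
  exact integral_mul_sq_le hf hTm hB hTB

/-- For a reversible kernel, every Rayleigh quotient of a bounded centred function is a lower bound
for every `L²`-geometric rate. -/
theorem integral_mul_kernelMean_le_rate_mul (hK : KernelSymmetric K π) (hf : Measurable f)
    (hB : ∀ x, |f x| ≤ 1) (h0 : ∫ x, f x ∂π = 0) {ρ : ℝ} (hρ0 : 0 ≤ ρ)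
    (hρ : IsL2GeometricRate K π ρ) :
    ∫ x, f x * kernelMean K f x ∂π ≤ ρ * ∫ x, f x ^ 2 ∂π := by
  obtain ⟨M, hM⟩ := exists_integral_mul_kernelMean_pow_le hK hf hB h0 hρ
  set a : ℕ → ℝ := fun m => ∫ x, f x * kernelMean (K ^ m) f x ∂π with ha
  set v := ∫ x, f x ^ 2 ∂π with hv
  have hsq : ∀ m, a m ^ 2 ≤ v * a (m + m) := sq_integral_mul_kernelMean_pow_le hK hf hB
  have ha1 : a 1 = ∫ x, f x * kernelMean K f x ∂π := by simp only [ha, pow_one]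
  rw [← ha1]
  have hv0 : 0 ≤ v := integral_nonneg fun x => sq_nonneg _
  by_contra! hlt
  have hvpos : 0 < v := by
    rcases hv0.eq_or_lt with h | h
    · have h2 := hsq 1
      rw [← h] at h2 hlt
      nlinarith
    · exact h
  set r := a 1 / v with hr
  have hρr : ρ < r := by rwa [hr, lt_div_iff₀ hvpos]
  have hr0 : 0 < r := hρ0.trans_lt hρr
  -- Doubling the lag squares the ratio `a m / v` at least. So the autocovariances stay above `v
  -- r^(2^k)`, which is incompatible with the bound `M ρ^(2^k)` when `ρ < r`.
  have hpow : ∀ k : ℕ, v * r ^ (2 ^ k) ≤ a (2 ^ k) := by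
    intro k
    induction k with
    | zero => simp [hr, mul_div_cancel₀ _ hvpos.ne']
    | succ k ih =>
      have h1 := hsq (2 ^ k)
      have h2 : (v * r ^ 2 ^ k) ^ 2 ≤ a (2 ^ k) ^ 2 := pow_le_pow_left₀ (by positivity) ih 2
      have h3 := h2.trans h1
      rw [pow_succ, pow_mul, mul_two]
      refine le_of_mul_le_mul_left ?_ hvpos
      nlinarith
  have hlim : Filter.Tendsto (fun k : ℕ => M * (ρ / r) ^ (2 ^ k)) Filter.atTop (nhds (M * 0)) :=
    ((tendsto_pow_atTop_nhds_zero_of_lt_one (by positivity) ((div_lt_one hr0).2 hρr)).comp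
      (tendsto_pow_atTop_atTop_of_one_lt one_lt_two)).const_mul M
  have hge : ∀ k : ℕ, v ≤ M * (ρ / r) ^ (2 ^ k) := by
    intro k
    rw [div_pow, ← mul_div_assoc, le_div_iff₀ (by positivity)]
    exact (hpow k).trans (hM _)
  have := ge_of_tendsto' hlim hge
  linarith

theorem l2Rate_le_one (K : Kernel S S) [IsMarkovKernel K] : l2Rate K π ≤ 1 := by
  refine csInf_le ⟨0, fun ρ h => h.1.1⟩ ⟨by simp, fun ν _ _ => ⟨1, fun m => ?_⟩⟩
  have := isMarkovKernel_pow K m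
  simpa using tvDist_le_one ((K ^ m) ∘ₘ ν) π

theorem le_l2Rate (K : Kernel S S) [IsMarkovKernel K] {r : ℝ}
    (h : ∀ ρ, 0 ≤ ρ → IsL2GeometricRate K π ρ → r ≤ ρ) : r ≤ l2Rate K π := by
  -- The rate `1` is always admissible, so the infimum is over a nonempty set; on the empty set
  -- `sInf` would be `0`.
  refine le_csInf ⟨1, ⟨by simp, fun ν _ _ => ⟨1, fun m => ?_⟩⟩⟩ fun ρ hρ => h ρ hρ.1.1 hρ.2
  have := isMarkovKernel_pow K m
  simpa using tvDist_le_one ((K ^ m) ∘ₘ ν) π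

end Rayleigh

/-! ### Rayleigh bound for observables that are not centred -/

section Rayleigh

variable {S : Type*} [MeasurableSpace S] {K : Kernel S S} [IsMarkovKernel K] {π : Measure S}
  [IsProbabilityMeasure π] {f : S → ℝ}

/-- The bound `integral_mul_kernelMean_le_rate_mul` for an observable that need not be centred. -/
theorem covariance_kernelMean_le_rate_mul (hK : KernelSymmetric K π) (hf : Measurable f)
    (hB : ∀ x, |f x| ≤ 1) {ρ : ℝ} (hρ0 : 0 ≤ ρ) (hρ : IsL2GeometricRate K π ρ) :
    ∫ x, f x * kernelMean K f x ∂π - (∫ x, f x ∂π) ^ 2 ≤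
      ρ * (∫ x, f x ^ 2 ∂π - (∫ x, f x ∂π) ^ 2) := by
  set c := ∫ x, f x ∂π with hc
  have hfi : Integrable f π := integrable_of_bounded hf hB
  have hc1 : |c| ≤ 1 := by
    simpa using norm_integral_le_of_norm_le_const (μ := π) (f := f) (C := 1) (.of_forall hB)
  -- Centring can double the sup norm; halving restores the bound `1`.
  have hg : Measurable fun x => (f x - c) / 2 := (hf.sub_const c).div_const 2
  have hgB : ∀ x, |(f x - c) / 2| ≤ 1 := fun x => by
    have h1 := abs_le.1 (hB x)
    have h2 := abs_le.1 hc1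
    exact abs_le.2 ⟨by linarith, by linarith⟩
  have hg0 : ∫ x, (f x - c) / 2 ∂π = 0 := by
    rw [integral_div, integral_sub hfi (integrable_const c)]
    simp [hc]
  have hKi := integrable_of_bounded (μ := π) (measurable_kernelMean K hf) (abs_kernelMean_le K hB)
  have hmul : ∀ {g : S → ℝ}, Measurable g → (∀ x, |g x| ≤ 1) →
      Integrable (fun x => f x * g x) π := fun hg hgB =>
    integrable_of_bounded (hf.mul hg) (B := 1) fun x => by
      rw [abs_mul]; exact mul_le_one₀ (hB x) (abs_nonneg _) (hgB x)
  have hKg : ∀ x, kernelMean K (fun x => (f x - c) / 2) x = (kernelMean K f x - c) / 2 := by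
    intro x
    rw [kernelMean, integral_div,
      integral_sub (integrable_of_bounded hf hB) (integrable_const c)]
    simp [kernelMean]
  have key := integral_mul_kernelMean_le_rate_mul hK hg hgB hg0 hρ0 hρ
  have e1 : ∫ x, (f x - c) / 2 * kernelMean K (fun x => (f x - c) / 2) x ∂π =
      (∫ x, f x * kernelMean K f x ∂π - c ^ 2) / 4 := by
    simp_rw [hKg]
    have : ∀ x, (f x - c) / 2 * ((kernelMean K f x - c) / 2) =
        (f x * kernelMean K f x - (c * f x + c * kernelMean K f x - c ^ 2)) / 4 :=
      fun x => by ring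
    simp_rw [this]
    have hs : Integrable (fun x => c * f x + c * kernelMean K f x) π :=
      (hfi.const_mul c).add (hKi.const_mul c)
    have hd : Integrable (fun x => c * f x + c * kernelMean K f x - c ^ 2) π :=
      hs.sub (integrable_const _)
    rw [integral_div, integral_sub (hmul (measurable_kernelMean K hf) (abs_kernelMean_le K hB)) hd,
      integral_sub hs (integrable_const _),
      integral_add (hfi.const_mul c) (hKi.const_mul c), integral_const_mul, integral_const_mul,
      hK.integral_kernelMean hf hB, ← hc]
    simp
    ring
  have e2 : ∫ x, ((f x - c) / 2) ^ 2 ∂π = (∫ x, f x ^ 2 ∂π - c ^ 2) / 4 := by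
    have : ∀ x, ((f x - c) / 2) ^ 2 = (f x * f x - (2 * c * f x - c ^ 2)) / 4 :=
      fun x => by ring
    simp_rw [this]
    have hd : Integrable (fun x => 2 * c * f x - c ^ 2) π :=
      (hfi.const_mul _).sub (integrable_const _)
    rw [integral_div, integral_sub (hmul hf hB) hd,
      integral_sub (hfi.const_mul _) (integrable_const _), integral_const_mul, ← hc]
    simp_rw [← pow_two]
    simp
    ring
  rw [e1, e2] at key
  linarith

end Rayleigh

/-! ### Data augmentation chains -/

section DataAugmentation

variable {S T : Type*} [MeasurableSpace S] [MeasurableSpace T] {π : Measure S}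
  [IsProbabilityMeasure π] {H : Measure T} [IsProbabilityMeasure H] {L : Kernel S T}
  [IsMarkovKernel L] {C : Kernel T S} [IsMarkovKernel C]

theorem integral_eq_integral_kernelMean_of_compProd
    (hj : π ⊗ₘ L = (H ⊗ₘ C).map Prod.swap) {f : S → ℝ} {B : ℝ} (hf : Measurable f)
    (hB : ∀ x, |f x| ≤ B) :
    ∫ x, f x ∂π = ∫ z, kernelMean C f z ∂H := by
  have h1 : ∫ q, f q.1 ∂(π ⊗ₘ L) = ∫ x, f x ∂π := by
    rw [Measure.integral_compProd (f := fun q : S × T => f q.1)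
      (integrable_of_bounded (hf.comp measurable_fst) fun q => hB q.1)]
    simp
  rw [← h1, hj, integral_map (f := fun q : S × T => f q.1) measurable_swap.aemeasurable
    (hf.comp measurable_fst).aestronglyMeasurable]
  simp only [Prod.fst_swap]
  rw [Measure.integral_compProd (f := fun q : T × S => f q.2)
    (integrable_of_bounded (hf.comp measurable_snd) fun q => hB q.2)]
  rfl

/-- Both sides are the integral of `f(x) (Cg)(z)` against the joint law, disintegrated in the two
orders. The right side is symmetric in `f` and `g`, which gives reversibility. -/
theorem integral_mul_kernelMean_comp (hj : π ⊗ₘ L = (H ⊗ₘ C).map Prod.swap) {f g : S → ℝ} {B : ℝ}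
    (hf : Measurable f) (hg : Measurable g) (hBf : ∀ x, |f x| ≤ B) (hBg : ∀ x, |g x| ≤ B) :
    ∫ x, f x * kernelMean (C ∘ₖ L) g x ∂π = ∫ z, kernelMean C f z * kernelMean C g z ∂H := by
  have hCg := measurable_kernelMean C hg
  have hCB := abs_kernelMean_le C hBg
  have hm : Measurable fun q : S × T => f q.1 * kernelMean C g q.2 :=
    (hf.comp measurable_fst).mul (hCg.comp measurable_snd)
  have hb : ∀ q : S × T, |f q.1 * kernelMean C g q.2| ≤ B * B := fun q => by
    rw [abs_mul]
    exact mul_le_mul (hBf _) (hCB _) (abs_nonneg _) ((abs_nonneg _).trans (hBf q.1))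
  have h1 : ∫ q, f q.1 * kernelMean C g q.2 ∂(π ⊗ₘ L) =
      ∫ x, f x * kernelMean (C ∘ₖ L) g x ∂π := by
    rw [Measure.integral_compProd (integrable_of_bounded hm hb), kernelMean_comp C L hg hBg]
    simp_rw [integral_const_mul]
    rfl
  rw [← h1, hj, integral_map measurable_swap.aemeasurable hm.aestronglyMeasurable]
  simp only [Prod.fst_swap, Prod.snd_swap]
  rw [Measure.integral_compProd (f := fun q : T × S => f q.2 * kernelMean C g q.1)
    (integrable_of_bounded (hm.comp measurable_swap) fun q => hb q.swap)]
  simp_rw [integral_mul_const]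
  rfl

theorem kernelSymmetric_comp (hj : π ⊗ₘ L = (H ⊗ₘ C).map Prod.swap) :
    KernelSymmetric (C ∘ₖ L) π := by
  intro f g B hf hg hBf hBg
  rw [integral_mul_kernelMean_comp hj hf hg hBf hBg]
  simp_rw [mul_comm (kernelMean (C ∘ₖ L) f _)]
  rw [integral_mul_kernelMean_comp hj hg hf hBg hBf]
  simp_rw [mul_comm]

end DataAugmentation

/-! ### Densities of Gaussian measures -/

section GaussianDensity

open scoped RealInnerProductSpace

variable (E : Type*) [NormedAddCommGroup E] [InnerProductSpace ℝ E] [FiniteDimensional ℝ E]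
  [MeasurableSpace E] [BorelSpace E]

theorem integrable_exp_neg_half_norm_sq : Integrable fun x : E => Real.exp (-(1 / 2) * ‖x‖ ^ 2) := by
  have h := (GaussianFourier.integrable_cexp_neg_mul_sq_norm_add (V := E) (b := 1 / 2)
    (by norm_num) 0 0).norm
  refine h.congr (.of_forall fun x => ?_)
  simp only [Complex.norm_exp]
  norm_num [← Complex.ofReal_pow]

/-- The standard Gaussian measure has a density proportional to `exp (-‖x‖² / 2)`. -/
theorem exists_withDensity_exp_eq_smul_stdGaussian :
    ∃ k : ℝ≥0∞, k ≠ 0 ∧ k ≠ ∞ ∧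
      (volume : Measure E).withDensity (fun x => ENNReal.ofReal (Real.exp (-(1 / 2) * ‖x‖ ^ 2))) =
        k • stdGaussian E := by
  have hi := integrable_exp_neg_half_norm_sq E
  set μ := (volume : Measure E).withDensity
    (fun x => ENNReal.ofReal (Real.exp (-(1 / 2) * ‖x‖ ^ 2))) with hμ
  have huniv : μ Set.univ = ENNReal.ofReal (∫ x : E, Real.exp (-(1 / 2) * ‖x‖ ^ 2)) := by
    rw [hμ, withDensity_apply _ .univ, Measure.restrict_univ,
      ofReal_integral_eq_lintegral_ofReal hi (.of_forall fun x => (Real.exp_pos _).le)]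
  have hfin : μ Set.univ ≠ ∞ := by rw [huniv]; exact ENNReal.ofReal_ne_top
  have hpos : μ Set.univ ≠ 0 := by
    rw [huniv, Ne, ENNReal.ofReal_eq_zero, not_le]
    exact integral_exp_pos hi
  have : IsFiniteMeasure μ := ⟨hfin.lt_top⟩
  refine ⟨μ Set.univ, hpos, hfin, ?_⟩
  have : IsFiniteMeasure (μ Set.univ • stdGaussian E) := by
    constructor
    simp
  -- The characteristic functions are proportional; evaluation at `0` identifies the factor as the
  -- total mass.
  have hchar : ∀ t, charFun μ t = ((Real.pi : ℂ) / (1 / 2)) ^ (Module.finrank ℝ E / 2 : ℂ) *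
      charFun (stdGaussian E) t := by
    intro t
    have h := GaussianFourier.integral_cexp_neg_mul_sq_norm_add (V := E) (b := 1 / 2)
      (by norm_num) Complex.I t
    rw [charFun_apply, hμ, integral_withDensity_eq_integral_toReal_smul (by fun_prop) (by simp),
      charFun_stdGaussian]
    convert h using 1
    · refine integral_congr_ae (.of_forall fun x => ?_)
      simp only
      rw [ENNReal.toReal_ofReal (Real.exp_pos _).le, Complex.real_smul, Complex.ofReal_exp,
        ← Complex.exp_add, real_inner_comm]
      congr 1
      push_cast
      ring
    · congr 2
      rw [Complex.I_sq]
      ring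
  have h0 : ((Real.pi : ℂ) / (1 / 2)) ^ (Module.finrank ℝ E / 2 : ℂ) = μ.real Set.univ := by
    have h := hchar 0
    rw [charFun_zero, charFun_zero] at h
    simpa using h.symm
  refine Measure.ext_of_charFun ?_
  funext t
  rw [hchar t, h0, charFun_apply, charFun_apply, integral_smul_measure]
  rfl

variable {ι : Type*} [Fintype ι] [DecidableEq ι]

theorem sqrt_inv_mul_mul_sqrt_inv {S : Matrix ι ι ℝ} (hS : S.PosDef) :
    CFC.sqrt S⁻¹ * S * CFC.sqrt S⁻¹ = 1 := by
  have h : CFC.sqrt S⁻¹ * CFC.sqrt S⁻¹ = S⁻¹ := CFC.sqrt_mul_sqrt_self _ hS.inv.posSemidef.nonneg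
  rw [mul_eq_one_comm, ← mul_assoc, h,
    Matrix.nonsing_inv_mul _ ((Matrix.isUnit_iff_isUnit_det _).1 hS.isUnit)]

/-- Integration against `N(m, S⁻¹)` in terms of its density, with a normalising constant that does
not depend on `m`. -/
theorem exists_lintegral_multivariateGaussian {S : Matrix ι ι ℝ} (hS : S.PosDef) :
    ∃ k : ℝ≥0∞, k ≠ 0 ∧ k ≠ ∞ ∧ ∀ (m : EuclideanSpace ℝ ι) (f : EuclideanSpace ℝ ι → ℝ≥0∞),
      Measurable f → ∫⁻ x, f x * ENNReal.ofReal
        (Real.exp (-(1 / 2) * ((x.ofLp - m.ofLp) ⬝ᵥ (S *ᵥ (x.ofLp - m.ofLp))))) =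
          k * ∫⁻ x, f x ∂multivariateGaussian m S⁻¹ := by
  obtain ⟨k, hk0, hk, hstd⟩ := exists_withDensity_exp_eq_smul_stdGaussian (EuclideanSpace ℝ ι)
  set R := CFC.sqrt S⁻¹ with hR
  have hRSR : R * S * R = 1 := sqrt_inv_mul_mul_sqrt_inv hS
  have hRt : Rᵀ = R := by
    have : R.PosSemidef := Matrix.nonneg_iff_posSemidef.1 (CFC.sqrt_nonneg S⁻¹)
    simpa using this.isHermitian.eq
  set A := toEuclideanCLM (𝕜 := ℝ) R with hA
  have hAx : ∀ x, (A x).ofLp = R *ᵥ x.ofLp := fun x => by simp [hA]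
  -- `N(m, S⁻¹)` is the image of the standard Gaussian under `x ↦ m + S^(-1/2) x`, which turns the
  -- quadratic form of `S` into `‖x‖²`. The Jacobian does not involve `m`, and this identity also
  -- makes the map injective.
  have hquad : ∀ x, (A x).ofLp ⬝ᵥ (S *ᵥ (A x).ofLp) = ‖x‖ ^ 2 := by
    intro x
    rw [hAx, dotProduct_comm, dotProduct_mulVec, ← mulVec_transpose, hRt, mulVec_mulVec,
      mulVec_mulVec, hRSR, one_mulVec, EuclideanSpace.real_norm_sq_eq, dotProduct]
    simp [pow_two]
  have hdet : LinearMap.det (A : EuclideanSpace ℝ ι →ₗ[ℝ] EuclideanSpace ℝ ι) ≠ 0 := by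
    refine (LinearMap.isUnit_iff_isUnit_det _).1 ?_ |>.ne_zero
    rw [LinearMap.isUnit_iff_ker_eq_bot, LinearMap.ker_eq_bot']
    intro x hx
    have h := hquad x
    have h0 : A x = 0 := hx
    rw [h0] at h
    simpa using h.symm
  set d := ENNReal.ofReal
    |(LinearMap.det (A : EuclideanSpace ℝ ι →ₗ[ℝ] EuclideanSpace ℝ ι))⁻¹| with hd
  have hd0 : d ≠ 0 := by simp [hd, hdet]
  have hdt : d ≠ ∞ := ENNReal.ofReal_ne_top
  refine ⟨d⁻¹ * k, mul_ne_zero (ENNReal.inv_ne_zero.2 hdt) hk0,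
    ENNReal.mul_ne_top (ENNReal.inv_ne_top.2 hd0) hk, fun m f hf => ?_⟩
  have hmap := Measure.map_linearMap_addHaar_eq_smul_addHaar
    (volume : Measure (EuclideanSpace ℝ ι)) hdet
  have hq : Measurable fun y : EuclideanSpace ℝ ι => y.ofLp ⬝ᵥ (S *ᵥ y.ofLp) := by
    have : Continuous fun y : EuclideanSpace ℝ ι => y.ofLp ⬝ᵥ (S *ᵥ y.ofLp) := by fun_prop
    exact this.measurable
  set F : EuclideanSpace ℝ ι → ℝ≥0∞ := fun y => f (m + y) *
    ENNReal.ofReal (Real.exp (-(1 / 2) * (y.ofLp ⬝ᵥ (S *ᵥ y.ofLp)))) with hF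
  have hFm : Measurable F := (hf.comp (measurable_const_add m)).mul
    (hq.const_mul _).exp.ennreal_ofReal
  have hfA : Measurable fun x => f (m + A x) := hf.comp (by fun_prop)
  have h1 : k * ∫⁻ x, f x ∂multivariateGaussian m S⁻¹ = d * ∫⁻ y, F y := by
    rw [multivariateGaussian, lintegral_map hf (by fun_prop), ← smul_eq_mul,
      ← lintegral_smul_measure, ← hstd,
      lintegral_withDensity_eq_lintegral_mul₀ (by fun_prop) hfA.aemeasurable, ← smul_eq_mul (a := d),
      ← lintegral_smul_measure, hd, ← hmap, lintegral_map hFm]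
    · refine lintegral_congr fun x => ?_
      simp only [Pi.mul_apply, hF]
      rw [mul_comm]
      congr 4
      exact (hquad x).symm
    · exact A.continuous.measurable
  rw [mul_assoc, h1, ← mul_assoc, ENNReal.inv_mul_cancel hd0 hdt, one_mul,
    ← lintegral_add_left_eq_self _ m]
  simp [hF]

end GaussianDensity

/-! ### Linear algebra of a single observation -/

section Algebra

variable {p : ℕ} {X : Matrix (Fin 1) (Fin p) ℝ} {Q : Matrix (Fin p) (Fin p) ℝ}

theorem sigmaMat_posDef {n : ℕ} (X : Matrix (Fin n) (Fin p) ℝ) (hQ : Q.PosDef) :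
    (sigmaMat X Q).PosDef := by
  have h : (Xᵀ * X).PosSemidef := by
    simpa using Matrix.posSemidef_conjTranspose_mul_self X
  exact Matrix.PosDef.posSemidef_add h hQ

theorem psi_eq_dotProduct (X : Matrix (Fin 1) (Fin p) ℝ) (Q : Matrix (Fin p) (Fin p) ℝ) :
    psi X Q = X 0 ⬝ᵥ ((sigmaMat X Q)⁻¹ *ᵥ X 0) := by
  rw [psi, Matrix.mul_assoc, Matrix.mul_apply]
  rfl

theorem mul_inv_mul_transpose_apply_eq_dotProduct (X : Matrix (Fin 1) (Fin p) ℝ)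
    (M : Matrix (Fin p) (Fin p) ℝ) : (X * M * Xᵀ) 0 0 = X 0 ⬝ᵥ (M *ᵥ X 0) := by
  rw [Matrix.mul_assoc, Matrix.mul_apply]
  rfl

theorem sigmaMat_mulVec (X : Matrix (Fin 1) (Fin p) ℝ) (Q : Matrix (Fin p) (Fin p) ℝ)
    (b : Fin p → ℝ) : sigmaMat X Q *ᵥ b = (X 0 ⬝ᵥ b) • X 0 + Q *ᵥ b := by
  rw [sigmaMat, add_mulVec, ← mulVec_mulVec]
  congr 1
  funext j
  simp [mulVec, dotProduct, mul_comm]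

theorem sigmaMat_mulVec_inv_mulVec (hQ : Q.PosDef) (b : Fin p → ℝ) :
    sigmaMat X Q *ᵥ ((sigmaMat X Q)⁻¹ *ᵥ b) = b := by
  rw [mulVec_mulVec, Matrix.mul_nonsing_inv _
    ((Matrix.isUnit_iff_isUnit_det _).1 (sigmaMat_posDef X hQ).isUnit), one_mulVec]

/-- `ψ = t / (1 + t)` with `t = X Q⁻¹ Xᵀ`. -/
theorem one_sub_psi_mul (X : Matrix (Fin 1) (Fin p) ℝ) (hQ : Q.PosDef) :
    (1 - psi X Q) * (1 + (X * Q⁻¹ * Xᵀ) 0 0) = 1 := by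
  have h := sigmaMat_mulVec_inv_mulVec (X := X) hQ (X 0)
  -- With `w = Σ⁻¹Xᵀ`, the equation `Σw = Xᵀ` reads `ψXᵀ + Qw = Xᵀ`; applying `XQ⁻¹` gives `ψ =
  -- (1-ψ)t`.
  rw [sigmaMat_mulVec, ← psi_eq_dotProduct] at h
  have h2 : Q *ᵥ ((sigmaMat X Q)⁻¹ *ᵥ X 0) = (1 - psi X Q) • X 0 := by
    rw [sub_smul, one_smul]; exact eq_sub_of_add_eq' h
  have h3 := congrArg (fun w => X 0 ⬝ᵥ (Q⁻¹ *ᵥ w)) h2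
  simp only [mulVec_mulVec] at h3
  rw [← Matrix.mul_assoc, Matrix.nonsing_inv_mul _ ((Matrix.isUnit_iff_isUnit_det _).1 hQ.isUnit),
    Matrix.one_mul, ← psi_eq_dotProduct, mulVec_smul, dotProduct_smul, smul_eq_mul,
    ← mul_inv_mul_transpose_apply_eq_dotProduct] at h3
  linarith

theorem mul_inv_mul_transpose_nonneg (X : Matrix (Fin 1) (Fin p) ℝ) (hQ : Q.PosDef) :
    0 ≤ (X * Q⁻¹ * Xᵀ) 0 0 := by
  rw [mul_inv_mul_transpose_apply_eq_dotProduct]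
  simpa using hQ.inv.posSemidef.dotProduct_mulVec_nonneg (X 0)

theorem psi_lt_one (X : Matrix (Fin 1) (Fin p) ℝ) (hQ : Q.PosDef) : psi X Q < 1 := by
  have h1 := one_sub_psi_mul X hQ
  have h2 := mul_inv_mul_transpose_nonneg X hQ
  by_contra! h
  nlinarith

/-- Completing the square in the joint density of the coefficients and the latent variable. -/
theorem sq_sub_add_quadratic (X : Matrix (Fin 1) (Fin p) ℝ) (hQ : Q.PosDef) (x : ℝ)
    (b : Fin p → ℝ) :
    (x - X 0 ⬝ᵥ b) ^ 2 + b ⬝ᵥ (Q *ᵥ b) =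
      (b - (sigmaMat X Q)⁻¹ *ᵥ (x • X 0)) ⬝ᵥ
        (sigmaMat X Q *ᵥ (b - (sigmaMat X Q)⁻¹ *ᵥ (x • X 0))) + (1 - psi X Q) * x ^ 2 := by
  have hS : (sigmaMat X Q)ᵀ = sigmaMat X Q := by
    simpa using (sigmaMat_posDef X hQ).isHermitian.eq
  have hb : b ⬝ᵥ (sigmaMat X Q *ᵥ b) = (X 0 ⬝ᵥ b) ^ 2 + b ⬝ᵥ (Q *ᵥ b) := by
    rw [sigmaMat_mulVec, dotProduct_add, dotProduct_smul, dotProduct_comm b (X 0), smul_eq_mul]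
    ring
  have hm := sigmaMat_mulVec_inv_mulVec (X := X) hQ (x • X 0)
  have hmX : ((sigmaMat X Q)⁻¹ *ᵥ (x • X 0)) ⬝ᵥ X 0 = x * psi X Q := by
    rw [dotProduct_comm, mulVec_smul, dotProduct_smul, ← psi_eq_dotProduct, smul_eq_mul]
  set m := (sigmaMat X Q)⁻¹ *ᵥ (x • X 0) with hmdef
  have hmb : m ⬝ᵥ (sigmaMat X Q *ᵥ b) = x * (X 0 ⬝ᵥ b) := by
    rw [dotProduct_mulVec, ← mulVec_transpose, hS, hm, smul_dotProduct, smul_eq_mul]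
  rw [mulVec_sub, hm, sub_dotProduct, dotProduct_sub, dotProduct_sub, hb, hmb, dotProduct_smul,
    dotProduct_smul, hmX, dotProduct_comm b (X 0), smul_eq_mul, smul_eq_mul]
  ring

end Algebra

/-! ### The joint law of the coefficients and the latent variable -/

section Joint

variable {p : ℕ} {X : Matrix (Fin 1) (Fin p) ℝ} {Q : Matrix (Fin p) (Fin p) ℝ}

theorem one_sub_stdNormalCDF (θ : ℝ) : 1 - stdNormalCDF θ = (gaussianReal θ 1).real (Set.Iio 0) := by
  have h1 : gaussianReal θ 1 = (gaussianReal 0 1).map (θ - ·) := by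
    rw [gaussianReal_map_const_sub]; simp
  rw [stdNormalCDF, cdf_eq_real, h1, map_measureReal_apply (by fun_prop) measurableSet_Iio,
    ← probReal_compl_eq_one_sub measurableSet_Iic]
  congr 1
  ext x
  simp

theorem stdNormalCDF_eq (θ : ℝ) : stdNormalCDF θ = (gaussianReal θ 1).real (Set.Ioi 0) := by
  have h1 : gaussianReal θ 1 = (gaussianReal 0 1).map (θ - ·) := by
    rw [gaussianReal_map_const_sub]; simp
  -- Reflection turns `Ioi 0` into the open `Iio θ`, whereas the distribution function uses `Iic θ`;
  -- the endpoint is not an atom.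
  have : NullSingletonClass (gaussianReal 0 1) := nullSingletonClass_gaussianReal one_ne_zero
  rw [stdNormalCDF, cdf_eq_real, h1, map_measureReal_apply (by fun_prop) measurableSet_Ioi,
    ← measureReal_congr Iio_ae_eq_Iic]
  congr 1
  ext x
  simp

theorem ofReal_posteriorWeight (X : Matrix (Fin 1) (Fin p) ℝ) (Y : Fin 1 → Bool)
    (Q : Matrix (Fin p) (Fin p) ℝ) (β : EuclideanSpace ℝ (Fin p)) :
    ENNReal.ofReal (posteriorWeight X Y Q 0 β) =
      gaussianReal (X 0 ⬝ᵥ β.ofLp) 1 (truncationSet (Y 0)) *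
        ENNReal.ofReal (Real.exp (-(1 / 2) * (β.ofLp ⬝ᵥ (Q *ᵥ β.ofLp)))) := by
  have h : posteriorWeight X Y Q 0 β =
      (gaussianReal (X 0 ⬝ᵥ β.ofLp) 1).real (truncationSet (Y 0)) *
        Real.exp (-(1 / 2) * (β.ofLp ⬝ᵥ (Q *ᵥ β.ofLp))) := by
    rw [posteriorWeight, sub_zero, Fin.prod_univ_one, truncationSet]
    congr 1
    cases Y 0
    · exact one_sub_stdNormalCDF _
    · exact stdNormalCDF_eq _
  rw [h, ENNReal.ofReal_mul measureReal_nonneg, ofReal_measureReal]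

/-- Unnormalised joint density of the coefficients and the latent variable. -/
def jointWeight (X : Matrix (Fin 1) (Fin p) ℝ) (Q : Matrix (Fin p) (Fin p) ℝ)
    (β : EuclideanSpace ℝ (Fin p)) (x : ℝ) : ℝ≥0∞ :=
  gaussianPDF (X 0 ⬝ᵥ β.ofLp) 1 x *
    ENNReal.ofReal (Real.exp (-(1 / 2) * (β.ofLp ⬝ᵥ (Q *ᵥ β.ofLp))))

theorem measurable_jointWeight :
    Measurable fun q : EuclideanSpace ℝ (Fin p) × ℝ => jointWeight X Q q.1 q.2 := by
  have h1 : Measurable fun β : EuclideanSpace ℝ (Fin p) => X 0 ⬝ᵥ β.ofLp := by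
    have : Continuous fun β : EuclideanSpace ℝ (Fin p) => X 0 ⬝ᵥ β.ofLp := by fun_prop
    exact this.measurable
  have h2 : Measurable fun β : EuclideanSpace ℝ (Fin p) => β.ofLp ⬝ᵥ (Q *ᵥ β.ofLp) := by
    have : Continuous fun β : EuclideanSpace ℝ (Fin p) => β.ofLp ⬝ᵥ (Q *ᵥ β.ofLp) := by fun_prop
    exact this.measurable
  unfold jointWeight gaussianPDF gaussianPDFReal
  have h3 : Measurable fun q : EuclideanSpace ℝ (Fin p) × ℝ => X 0 ⬝ᵥ q.1.ofLp :=
    h1.comp measurable_fst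
  have h4 : Measurable fun q : EuclideanSpace ℝ (Fin p) × ℝ => q.1.ofLp ⬝ᵥ (Q *ᵥ q.1.ofLp) :=
    h2.comp measurable_fst
  fun_prop

theorem lintegral_latentKernel (X : Matrix (Fin 1) (Fin p) ℝ) (Y : Fin 1 → Bool)
    (β : EuclideanSpace ℝ (Fin p)) {g : (Fin 1 → ℝ) → ℝ≥0∞} (hg : Measurable g) :
    ∫⁻ z, g z ∂latentKernel X Y β = ∫⁻ x, g (fun _ => x) ∂truncNormal (X 0 ⬝ᵥ β.ofLp) (Y 0) := by
  have h : latentKernel X Y β = Measure.pi fun _ : Fin 1 => truncNormal (X 0 ⬝ᵥ β.ofLp) (Y 0) := by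
    change (Measure.pi fun i => truncNormal ((X *ᵥ β.ofLp) i) (Y i)) = _
    congr 1
    funext i
    rw [Subsingleton.elim i 0]
    rfl
  have hm := (measurePreserving_funUnique (truncNormal (X 0 ⬝ᵥ β.ofLp) (Y 0)) (Fin 1)).symm
  rw [h]
  exact (hm.lintegral_comp hg).symm

/-- The probit factor of the posterior is exactly the normalising constant of the truncated normal,
so the two cancel. -/
theorem posteriorWeight_mul_lintegral_latentKernel (X : Matrix (Fin 1) (Fin p) ℝ)
    (Y : Fin 1 → Bool) (Q : Matrix (Fin p) (Fin p) ℝ) (β : EuclideanSpace ℝ (Fin p))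
    {g : (Fin 1 → ℝ) → ℝ≥0∞} (hg : Measurable g) :
    ENNReal.ofReal (posteriorWeight X Y Q 0 β) * ∫⁻ z, g z ∂latentKernel X Y β =
      ∫⁻ x in truncationSet (Y 0), jointWeight X Q β x * g (fun _ => x) := by
  have hA := measurableSet_truncationSet (Y 0)
  have hg' : Measurable fun x : ℝ => g fun _ => x := hg.comp (by fun_prop)
  rw [ofReal_posteriorWeight, lintegral_latentKernel X Y β hg, truncNormal, ProbabilityTheory.cond,
    lintegral_smul_measure, smul_eq_mul]
  have h0 := gaussianReal_truncationSet_ne_zero (X 0 ⬝ᵥ β.ofLp) (Y 0)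
  have h1 := measure_ne_top (gaussianReal (X 0 ⬝ᵥ β.ofLp) 1) (truncationSet (Y 0))
  rw [mul_right_comm, ← mul_assoc, ENNReal.mul_inv_cancel h0 h1, one_mul,
    gaussianReal_of_var_ne_zero _ one_ne_zero, restrict_withDensity hA,
    lintegral_withDensity_eq_lintegral_mul _ (measurable_gaussianPDF _ _) hg',
    ← lintegral_mul_const _ ((measurable_gaussianPDF _ _).mul hg')]
  refine lintegral_congr fun x => ?_
  simp only [Pi.mul_apply, jointWeight]
  ring

/-- Variance of the latent variable before truncation. -/
def latentVar (X : Matrix (Fin 1) (Fin p) ℝ) (Q : Matrix (Fin p) (Fin p) ℝ) : NNReal :=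
  ((1 - psi X Q)⁻¹).toNNReal

theorem coe_latentVar (X : Matrix (Fin 1) (Fin p) ℝ) (hQ : Q.PosDef) :
    (latentVar X Q : ℝ) = (1 - psi X Q)⁻¹ :=
  Real.coe_toNNReal _ (inv_nonneg.2 (sub_nonneg.2 (psi_lt_one X hQ).le))

theorem latentVar_ne_zero (X : Matrix (Fin 1) (Fin p) ℝ) (hQ : Q.PosDef) : latentVar X Q ≠ 0 := by
  rw [← NNReal.coe_ne_zero, coe_latentVar X hQ]
  exact inv_ne_zero (sub_pos.2 (psi_lt_one X hQ)).ne'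

/-- Completing the square splits the exponent into that of the conditional law of `β` given `x` and
the remainder `(1-ψ)x²`, a centred Gaussian of variance `1/(1-ψ)`. The constant `κ` collects
normalisations free of `x`. -/
theorem exists_lintegral_jointWeight (X : Matrix (Fin 1) (Fin p) ℝ) (hQ : Q.PosDef) :
    ∃ κ : ℝ≥0∞, κ ≠ 0 ∧ κ ≠ ∞ ∧ ∀ (x : ℝ) (f : EuclideanSpace ℝ (Fin p) → ℝ≥0∞), Measurable f →
      ∫⁻ β, jointWeight X Q β x * f β =
        κ * (gaussianPDF 0 (latentVar X Q) x * ∫⁻ β, f β ∂coefKernel X Q 0 (fun _ => x)) := by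
  obtain ⟨k, hk0, hk, hlin⟩ := exists_lintegral_multivariateGaussian (sigmaMat_posDef X hQ)
  set V := latentVar X Q with hV
  have hVr : (V : ℝ) = (1 - psi X Q)⁻¹ := coe_latentVar X hQ
  have hpos : 0 < 1 - psi X Q := sub_pos.2 (psi_lt_one X hQ)
  have hVpos : 0 < (V : ℝ) := hVr ▸ inv_pos.2 hpos
  have hc : 0 < (√(2 * Real.pi * 1))⁻¹ * √(2 * Real.pi * V) := by positivity
  refine ⟨ENNReal.ofReal ((√(2 * Real.pi * 1))⁻¹ * √(2 * Real.pi * V)) * k,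
    mul_ne_zero (ENNReal.ofReal_pos.2 hc).ne' hk0, ENNReal.mul_ne_top ENNReal.ofReal_ne_top hk,
    fun x f hf => ?_⟩
  have hmean : WithLp.toLp 2 ((sigmaMat X Q)⁻¹ *ᵥ (Xᵀ *ᵥ (fun _ => x) + Q *ᵥ 0)) =
      WithLp.toLp 2 ((sigmaMat X Q)⁻¹ *ᵥ (x • X 0)) := by
    congr 2
    rw [mulVec_zero, add_zero]
    funext j
    simp [mulVec, dotProduct, mul_comm]
  have hcoef : coefKernel X Q 0 (fun _ => x) = multivariateGaussian
      (WithLp.toLp 2 ((sigmaMat X Q)⁻¹ *ᵥ (x • X 0))) (sigmaMat X Q)⁻¹ := by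
    rw [← hmean]; rfl
  have h := hlin (WithLp.toLp 2 ((sigmaMat X Q)⁻¹ *ᵥ (x • X 0))) f hf
  have hj : ∀ β : EuclideanSpace ℝ (Fin p), jointWeight X Q β x =
      ENNReal.ofReal ((√(2 * Real.pi * 1))⁻¹ * √(2 * Real.pi * V)) * gaussianPDF 0 V x *
        ENNReal.ofReal (Real.exp (-(1 / 2) *
          ((β.ofLp - (sigmaMat X Q)⁻¹ *ᵥ (x • X 0)) ⬝ᵥ
            (sigmaMat X Q *ᵥ (β.ofLp - (sigmaMat X Q)⁻¹ *ᵥ (x • X 0)))))) := by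
    intro β
    have hsq := sq_sub_add_quadratic X hQ x β.ofLp
    rw [jointWeight, gaussianPDF, gaussianPDF, ← ENNReal.ofReal_mul (gaussianPDFReal_nonneg _ _ _),
      ← ENNReal.ofReal_mul hc.le,
      ← ENNReal.ofReal_mul (mul_nonneg hc.le (gaussianPDFReal_nonneg _ _ _))]
    congr 1
    rw [gaussianPDFReal, gaussianPDFReal]
    have hs : √(2 * Real.pi * V) ≠ 0 := by positivity
    have e : ∀ a b c d : ℝ, a * √(2 * Real.pi * V) * ((√(2 * Real.pi * V))⁻¹ * c) * d =
        a * (c * d) := by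
      intro a b c d
      field_simp
    rw [e _ 0, mul_assoc, ← Real.exp_add, ← Real.exp_add, hVr]
    push_cast
    congr 2
    field_simp
    linarith
  simp_rw [hj]
  simp_rw [mul_assoc, mul_comm (ENNReal.ofReal (Real.exp _)) (f _)]
  rw [lintegral_const_mul' _ _ ENNReal.ofReal_ne_top,
    lintegral_const_mul' _ _ (by simp [gaussianPDF]), hcoef]
  rw [h]
  ring

end Joint

/-! ### Normalisation and the two disintegrations of the stationary joint law -/

section Joint

variable {n p : ℕ}

instance isMarkovKernel_latentKernel (X : Matrix (Fin n) (Fin p) ℝ) (Y : Fin n → Bool) :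
    IsMarkovKernel (latentKernel X Y) :=
  ⟨fun β => inferInstanceAs
    (IsProbabilityMeasure (Measure.pi fun i => truncNormal ((X *ᵥ β.ofLp) i) (Y i)))⟩

instance isMarkovKernel_coefKernel (X : Matrix (Fin n) (Fin p) ℝ) (Q : Matrix (Fin p) (Fin p) ℝ)
    (v : Fin p → ℝ) : IsMarkovKernel (coefKernel X Q v) :=
  ⟨fun z => inferInstanceAs (IsProbabilityMeasure (multivariateGaussian
    (WithLp.toLp 2 ((sigmaMat X Q)⁻¹ *ᵥ (Xᵀ *ᵥ z + Q *ᵥ v))) (sigmaMat X Q)⁻¹))⟩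

variable {X : Matrix (Fin 1) (Fin p) ℝ} {Q : Matrix (Fin p) (Fin p) ℝ}

theorem measurable_ofReal_posteriorWeight (X : Matrix (Fin 1) (Fin p) ℝ) (Y : Fin 1 → Bool)
    (Q : Matrix (Fin p) (Fin p) ℝ) :
    Measurable fun β => ENNReal.ofReal (posteriorWeight X Y Q 0 β) := by
  have h1 : Measurable fun β : EuclideanSpace ℝ (Fin p) => X 0 ⬝ᵥ β.ofLp := by
    have : Continuous fun β : EuclideanSpace ℝ (Fin p) => X 0 ⬝ᵥ β.ofLp := by fun_prop
    exact this.measurable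
  have h2 : Measurable fun β : EuclideanSpace ℝ (Fin p) => β.ofLp ⬝ᵥ (Q *ᵥ β.ofLp) := by
    have : Continuous fun β : EuclideanSpace ℝ (Fin p) => β.ofLp ⬝ᵥ (Q *ᵥ β.ofLp) := by fun_prop
    exact this.measurable
  simp_rw [ofReal_posteriorWeight]
  exact ((measurable_gaussianReal_mean (measurableSet_truncationSet _)).comp h1).mul
    (h2.const_mul _).exp.ennreal_ofReal

/-- Tonelli applied to the joint weight. One `κ` serves every `G`, so `G = 1` gives the normalising
constant of the posterior and `κ` never has to be computed. -/
theorem exists_lintegral_posteriorWeight_mul (X : Matrix (Fin 1) (Fin p) ℝ) (Y : Fin 1 → Bool)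
    (hQ : Q.PosDef) :
    ∃ κ : ℝ≥0∞, κ ≠ 0 ∧ κ ≠ ∞ ∧ ∀ G : EuclideanSpace ℝ (Fin p) × (Fin 1 → ℝ) → ℝ≥0∞,
      Measurable G →
      ∫⁻ β, ENNReal.ofReal (posteriorWeight X Y Q 0 β) * ∫⁻ z, G (β, z) ∂latentKernel X Y β =
        κ * ∫⁻ x in truncationSet (Y 0), ∫⁻ β, G (β, fun _ => x) ∂coefKernel X Q 0 (fun _ => x)
          ∂gaussianReal 0 (latentVar X Q) := by
  obtain ⟨κ, hκ0, hκ, h⟩ := exists_lintegral_jointWeight X hQ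
  refine ⟨κ, hκ0, hκ, fun G hG => ?_⟩
  have hA := measurableSet_truncationSet (Y 0)
  have hGx : Measurable fun q : EuclideanSpace ℝ (Fin p) × ℝ => G (q.1, fun _ => q.2) :=
    hG.comp (by fun_prop)
  have hC : Measurable fun z => ∫⁻ β, G (β, z) ∂coefKernel X Q 0 z :=
    Measurable.lintegral_kernel_prod_left hG
  have hCx : Measurable fun x : ℝ => ∫⁻ β, G (β, fun _ => x) ∂coefKernel X Q 0 (fun _ => x) :=
    hC.comp (g := fun z => ∫⁻ β, G (β, z) ∂coefKernel X Q 0 z)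
      (f := fun (x : ℝ) (_ : Fin 1) => x) (by fun_prop)
  have hswap : Measurable (Function.uncurry fun (β : EuclideanSpace ℝ (Fin p)) (x : ℝ) =>
      jointWeight X Q β x * G (β, fun _ => x)) := measurable_jointWeight.mul hGx
  have h1 : ∀ β, ENNReal.ofReal (posteriorWeight X Y Q 0 β) *
      ∫⁻ z, G (β, z) ∂latentKernel X Y β =
      ∫⁻ x in truncationSet (Y 0), jointWeight X Q β x * G (β, fun _ => x) := fun β =>
    posteriorWeight_mul_lintegral_latentKernel X Y Q β (hG.comp measurable_prodMk_left)
  simp_rw [h1]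
  rw [lintegral_lintegral_swap hswap.aemeasurable,
    gaussianReal_of_var_ne_zero _ (latentVar_ne_zero X hQ), restrict_withDensity hA,
    lintegral_withDensity_eq_lintegral_mul _ (measurable_gaussianPDF _ _) hCx,
    ← lintegral_const_mul _ ((measurable_gaussianPDF _ _).mul hCx)]
  exact lintegral_congr fun x => h x _ (hGx.comp measurable_prodMk_right)

theorem gaussianReal_zero_truncationSet_ne_zero (y : Bool) {V : NNReal} (hV : V ≠ 0) :
    gaussianReal 0 V (truncationSet y) ≠ 0 := by
  intro h
  have h2 := gaussianReal_absolutelyContinuous' 0 hV h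
  unfold truncationSet at h2
  split at h2 <;> simp at h2

/-- Stationary law of the latent variable. -/
def latentMarginal (X : Matrix (Fin 1) (Fin p) ℝ) (Y : Fin 1 → Bool)
    (Q : Matrix (Fin p) (Fin p) ℝ) : Measure (Fin 1 → ℝ) :=
  ((gaussianReal 0 (latentVar X Q))[|truncationSet (Y 0)]).map fun x _ => x

theorem isProbabilityMeasure_latentMarginal (X : Matrix (Fin 1) (Fin p) ℝ) (Y : Fin 1 → Bool)
    (hQ : Q.PosDef) : IsProbabilityMeasure (latentMarginal X Y Q) := by
  have := cond_isProbabilityMeasure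
    (gaussianReal_zero_truncationSet_ne_zero (Y 0) (latentVar_ne_zero X hQ))
  exact Measure.isProbabilityMeasure_map (by fun_prop)

theorem lintegral_posteriorWeight_ne (X : Matrix (Fin 1) (Fin p) ℝ) (Y : Fin 1 → Bool)
    (hQ : Q.PosDef) : ∫⁻ β, ENNReal.ofReal (posteriorWeight X Y Q 0 β) ≠ 0 ∧
      ∫⁻ β, ENNReal.ofReal (posteriorWeight X Y Q 0 β) ≠ ∞ := by
  obtain ⟨κ, hκ0, hκ, h⟩ := exists_lintegral_posteriorWeight_mul X Y hQ
  have h1 := h (fun _ => 1) measurable_const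
  simp only [lintegral_const, measure_univ, mul_one, Measure.restrict_apply_univ, one_mul] at h1
  rw [h1]
  exact ⟨mul_ne_zero hκ0 (gaussianReal_zero_truncationSet_ne_zero (Y 0) (latentVar_ne_zero X hQ)),
    ENNReal.mul_ne_top hκ (measure_ne_top _ _)⟩

theorem isProbabilityMeasure_posterior (X : Matrix (Fin 1) (Fin p) ℝ) (Y : Fin 1 → Bool)
    (hQ : Q.PosDef) : IsProbabilityMeasure (posterior X Y Q 0) := by
  obtain ⟨h0, h1⟩ := lintegral_posteriorWeight_ne X Y hQ
  constructor
  rw [_root_.posterior, Measure.smul_apply, withDensity_apply _ .univ, Measure.restrict_univ, smul_eq_mul,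
    ENNReal.inv_mul_cancel h0 h1]

/-- The joint stationary law of coefficients and latent variable, disintegrated in both orders. -/
theorem posterior_compProd_latentKernel (X : Matrix (Fin 1) (Fin p) ℝ) (Y : Fin 1 → Bool)
    (hQ : Q.PosDef) : posterior X Y Q 0 ⊗ₘ latentKernel X Y =
      (latentMarginal X Y Q ⊗ₘ coefKernel X Q 0).map Prod.swap := by
  have := isProbabilityMeasure_posterior X Y hQ
  have := isProbabilityMeasure_latentMarginal X Y hQ
  obtain ⟨κ, hκ0, hκ, h⟩ := exists_lintegral_posteriorWeight_mul X Y hQ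
  have h1 := h (fun _ => 1) measurable_const
  simp only [lintegral_const, measure_univ, mul_one, Measure.restrict_apply_univ, one_mul] at h1
  refine Measure.ext_of_lintegral _ fun G hG => ?_
  have hL : Measurable fun β => ∫⁻ z, G (β, z) ∂latentKernel X Y β :=
    Measurable.lintegral_kernel_prod_right hG
  have hC : Measurable fun z => ∫⁻ β, G (β, z) ∂coefKernel X Q 0 z :=
    Measurable.lintegral_kernel_prod_left hG
  rw [Measure.lintegral_compProd hG, lintegral_map hG measurable_swap,
    Measure.lintegral_compProd (f := fun q => G q.swap) (hG.comp measurable_swap),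
    _root_.posterior, lintegral_smul_measure,
    lintegral_withDensity_eq_lintegral_mul _ (measurable_ofReal_posteriorWeight X Y Q) hL]
  simp only [Pi.mul_apply, Prod.swap_prod_mk]
  rw [h G hG, h1, latentMarginal, lintegral_map hC (by fun_prop), ProbabilityTheory.cond,
    lintegral_smul_measure, smul_eq_mul, smul_eq_mul,
    ENNReal.mul_inv (.inl hκ0) (.inl hκ), mul_mul_mul_comm, ENNReal.inv_mul_cancel hκ0 hκ, one_mul]

end Joint

/-! ### Trigonometric moments -/

section Trig

theorem integral_cos_eq_re_charFun {E : Type*} [NormedAddCommGroup E] [InnerProductSpace ℝ E]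
    [MeasurableSpace E] [BorelSpace E] [SecondCountableTopology E] (μ : Measure E)
    [IsFiniteMeasure μ] (t : E) : ∫ x, Real.cos (inner ℝ x t) ∂μ = (charFun μ t).re := by
  have hi : Integrable (fun x => Complex.exp (inner ℝ x t * Complex.I)) μ :=
    .of_bound (by fun_prop) 1 (.of_forall fun x => by rw [Complex.norm_exp_ofReal_mul_I])
  have h := integral_re hi
  rw [charFun_apply]
  refine Eq.trans (integral_congr_ae (.of_forall fun x => ?_)) h
  exact (Complex.exp_ofReal_mul_I_re _).symm

theorem integral_cos_mul_gaussianReal (V : NNReal) (b : ℝ) :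
    ∫ x, Real.cos (b * x) ∂gaussianReal 0 V = Real.exp (-(b ^ 2 * V / 2)) := by
  have h := integral_cos_eq_re_charFun (gaussianReal 0 V) b
  rw [charFun_gaussianReal] at h
  have e : (b : ℂ) * (0 : ℝ) * Complex.I - V * b ^ 2 / 2 = ((-(b ^ 2 * V / 2) : ℝ) : ℂ) := by
    push_cast
    ring
  rw [e, Complex.exp_ofReal_re] at h
  simpa using h

variable {g : ℝ → ℝ}

theorem integral_eq_two_mul_setIntegral_truncationSet {V : NNReal} (hV : V ≠ 0)
    (hi : Integrable g (gaussianReal 0 V)) (heven : ∀ x, g (-x) = g x) (y : Bool) :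
    ∫ x, g x ∂gaussianReal 0 V = 2 * ∫ x in truncationSet y, g x ∂gaussianReal 0 V := by
  have : NullSingletonClass (gaussianReal 0 V) := nullSingletonClass_gaussianReal hV
  have hmp : MeasurePreserving (fun x : ℝ => -x) (gaussianReal 0 V) (gaussianReal 0 V) :=
    ⟨measurable_neg, by rw [gaussianReal_map_neg, neg_zero]⟩
  have h1 : ∫ x in Set.Iio 0, g x ∂gaussianReal 0 V = ∫ x in Set.Ioi 0, g x ∂gaussianReal 0 V := by
    have h := hmp.setIntegral_preimage_emb (MeasurableEquiv.neg ℝ).measurableEmbedding g (Set.Ioi 0)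
    rw [← h]
    simp [heven]
  have h2 := integral_add_compl (measurableSet_Iio (a := (0 : ℝ))) hi
  rw [Set.compl_Iio, integral_Ici_eq_integral_Ioi] at h2
  unfold truncationSet
  split <;> linarith

/-- A centred Gaussian gives each half-line mass `1/2`, and an even function has half its integral
there. This is where the dependence on the response disappears. -/
theorem integral_cond_truncationSet_of_even {V : NNReal} (hV : V ≠ 0)
    (hi : Integrable g (gaussianReal 0 V)) (heven : ∀ x, g (-x) = g x) (y : Bool) :
    ∫ x, g x ∂(gaussianReal 0 V)[|truncationSet y] = ∫ x, g x ∂gaussianReal 0 V := by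
  have h1 := integral_eq_two_mul_setIntegral_truncationSet hV hi heven y
  have h2 := integral_eq_two_mul_setIntegral_truncationSet hV (integrable_const (1 : ℝ))
    (fun _ => rfl) y
  simp only [integral_const, probReal_univ, smul_eq_mul, mul_one, measureReal_restrict_apply_univ]
    at h2
  have h3 : (gaussianReal 0 V).real (truncationSet y) = 2⁻¹ := by linarith
  rw [ProbabilityTheory.cond, integral_smul_measure, ENNReal.toReal_inv, ← measureReal_def, h3, h1]
  simp

variable {p : ℕ} {X : Matrix (Fin 1) (Fin p) ℝ} {Q : Matrix (Fin p) (Fin p) ℝ}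

/-- Given `z`, the variable `Xβ` is `N(ψz, ψ)`; this is the real part of its characteristic function
at `r`. -/
theorem kernelMean_coefKernel_cos (hQ : Q.PosDef) (r : ℝ) (z : Fin 1 → ℝ) :
    kernelMean (coefKernel X Q 0) (fun β => Real.cos (r * (X 0 ⬝ᵥ β.ofLp))) z =
      Real.exp (-(r ^ 2 * psi X Q / 2)) * Real.cos (r * psi X Q * z 0) := by
  have hmean : (sigmaMat X Q)⁻¹ *ᵥ (Xᵀ *ᵥ z + Q *ᵥ 0) = z 0 • ((sigmaMat X Q)⁻¹ *ᵥ X 0) := by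
    rw [mulVec_zero, add_zero, ← mulVec_smul]
    congr 1
    funext j
    simp [mulVec, dotProduct, mul_comm]
  have hcoef : coefKernel X Q 0 z = multivariateGaussian
      (WithLp.toLp 2 (z 0 • ((sigmaMat X Q)⁻¹ *ᵥ X 0))) (sigmaMat X Q)⁻¹ := by
    rw [← hmean]; rfl
  have h := integral_cos_eq_re_charFun (coefKernel X Q 0 z) (WithLp.toLp 2 (r • X 0))
  rw [hcoef, charFun_multivariateGaussian (sigmaMat_posDef X hQ).inv.posSemidef] at h
  have e1 : ∀ β : EuclideanSpace ℝ (Fin p),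
      inner ℝ β (WithLp.toLp 2 (r • X 0)) = r * (X 0 ⬝ᵥ β.ofLp) := by
    intro β
    rw [EuclideanSpace.inner_eq_star_dotProduct]
    simp
  have e2 : (r • X 0) ⬝ᵥ ((sigmaMat X Q)⁻¹ *ᵥ (r • X 0)) = r ^ 2 * psi X Q := by
    rw [mulVec_smul, dotProduct_smul, smul_dotProduct, ← psi_eq_dotProduct, smul_eq_mul,
      smul_eq_mul]
    ring
  have e3 : inner ℝ (WithLp.toLp 2 (r • X 0) : EuclideanSpace ℝ (Fin p))
      (WithLp.toLp 2 (z 0 • ((sigmaMat X Q)⁻¹ *ᵥ X 0))) = r * psi X Q * z 0 := by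
    rw [real_inner_comm, e1, dotProduct_smul, ← psi_eq_dotProduct, smul_eq_mul]
    ring
  simp only [e1, e2, e3] at h
  have e4 : ((r * psi X Q * z 0 : ℝ) : ℂ) * Complex.I - ((r ^ 2 * psi X Q : ℝ) : ℂ) / 2 =
      ((-(r ^ 2 * psi X Q / 2) : ℝ) : ℂ) + ((r * psi X Q * z 0 : ℝ) : ℂ) * Complex.I := by
    push_cast
    ring
  rw [kernelMean, hcoef, h, e4, Complex.exp_add, ← Complex.ofReal_exp, Complex.re_ofReal_mul,
    Complex.exp_ofReal_mul_I_re]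

theorem integral_latentMarginal_of_even (hQ : Q.PosDef) (Y : Fin 1 → Bool) (hg : Measurable g)
    {B : ℝ} (hB : ∀ x, |g x| ≤ B) (heven : ∀ x, g (-x) = g x) :
    ∫ z, g (z 0) ∂latentMarginal X Y Q = ∫ x, g x ∂gaussianReal 0 (latentVar X Q) := by
  rw [latentMarginal, integral_map (f := fun z : Fin 1 → ℝ => g (z 0)) (by fun_prop)
    (hg.comp (measurable_pi_apply 0)).aestronglyMeasurable]
  exact integral_cond_truncationSet_of_even (latentVar_ne_zero X hQ) (integrable_of_bounded hg hB)
    heven (Y 0)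

theorem integral_latentMarginal_cos (hQ : Q.PosDef) (Y : Fin 1 → Bool) (b : ℝ) :
    ∫ z, Real.cos (b * z 0) ∂latentMarginal X Y Q =
      Real.exp (-(b ^ 2 * (1 - psi X Q)⁻¹ / 2)) := by
  rw [integral_latentMarginal_of_even (g := fun x => Real.cos (b * x)) hQ Y (by fun_prop)
    (fun x => Real.abs_cos_le_one _) (fun x => by rw [mul_neg, Real.cos_neg]),
    integral_cos_mul_gaussianReal, coe_latentVar X hQ]

theorem measurable_cos_mul_dotProduct (X : Matrix (Fin 1) (Fin p) ℝ) (r : ℝ) :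
    Measurable fun β : EuclideanSpace ℝ (Fin p) => Real.cos (r * (X 0 ⬝ᵥ β.ofLp)) := by
  have : Continuous fun β : EuclideanSpace ℝ (Fin p) => Real.cos (r * (X 0 ⬝ᵥ β.ofLp)) := by
    fun_prop
  exact this.measurable

theorem integral_posterior_cos (hQ : Q.PosDef) (Y : Fin 1 → Bool) (r : ℝ) :
    ∫ β, Real.cos (r * (X 0 ⬝ᵥ β.ofLp)) ∂posterior X Y Q 0 =
      Real.exp (-(r ^ 2 * psi X Q * (1 - psi X Q)⁻¹ / 2)) := by
  have := isProbabilityMeasure_posterior X Y hQ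
  have := isProbabilityMeasure_latentMarginal X Y hQ
  have hne : 1 - psi X Q ≠ 0 := (sub_pos.2 (psi_lt_one X hQ)).ne'
  rw [integral_eq_integral_kernelMean_of_compProd (posterior_compProd_latentKernel X Y hQ)
    (measurable_cos_mul_dotProduct X r) (fun β => Real.abs_cos_le_one _)]
  simp_rw [kernelMean_coefKernel_cos hQ]
  rw [integral_const_mul, integral_latentMarginal_cos hQ, ← Real.exp_add]
  congr 1
  field_simp
  ring

theorem integral_cos_sq_eq_half {S : Type*} [MeasurableSpace S] {μ : Measure S} [IsProbabilityMeasure μ]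
    {u : S → ℝ} (hu : Measurable u) :
    ∫ x, Real.cos (u x) ^ 2 ∂μ = (1 + ∫ x, Real.cos (2 * u x) ∂μ) / 2 := by
  have hm : Measurable fun x => Real.cos (2 * u x) := by fun_prop
  have hi : Integrable (fun x => Real.cos (2 * u x)) μ :=
    integrable_of_bounded hm fun x => Real.abs_cos_le_one _
  have h : ∀ x, Real.cos (u x) ^ 2 = (1 + Real.cos (2 * u x)) / 2 := fun x => by
    rw [Real.cos_sq]; ring
  simp_rw [h]
  rw [integral_div, integral_add (integrable_const _) hi]
  simp

theorem integral_posterior_cos_sq (hQ : Q.PosDef) (Y : Fin 1 → Bool) (r : ℝ) :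
    ∫ β, Real.cos (r * (X 0 ⬝ᵥ β.ofLp)) ^ 2 ∂posterior X Y Q 0 =
      (1 + Real.exp (-(2 * r ^ 2 * psi X Q * (1 - psi X Q)⁻¹))) / 2 := by
  have := isProbabilityMeasure_posterior X Y hQ
  have hm : Measurable fun β : EuclideanSpace ℝ (Fin p) => r * (X 0 ⬝ᵥ β.ofLp) := by
    have : Continuous fun β : EuclideanSpace ℝ (Fin p) => r * (X 0 ⬝ᵥ β.ofLp) := by fun_prop
    exact this.measurable
  rw [integral_cos_sq_eq_half hm]
  simp_rw [← mul_assoc]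
  rw [integral_posterior_cos hQ]
  congr 3
  ring

theorem integral_cos_mul_kernelMean_acKernel (hQ : Q.PosDef) (Y : Fin 1 → Bool) (r : ℝ) :
    ∫ β, Real.cos (r * (X 0 ⬝ᵥ β.ofLp)) *
      kernelMean (acKernel X Y Q 0) (fun β => Real.cos (r * (X 0 ⬝ᵥ β.ofLp))) β
        ∂posterior X Y Q 0 =
      Real.exp (-(r ^ 2 * psi X Q)) *
        ((1 + Real.exp (-(2 * r ^ 2 * psi X Q ^ 2 * (1 - psi X Q)⁻¹))) / 2) := by
  have := isProbabilityMeasure_posterior X Y hQ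
  have := isProbabilityMeasure_latentMarginal X Y hQ
  have hm := measurable_cos_mul_dotProduct X r
  rw [acKernel, integral_mul_kernelMean_comp (posterior_compProd_latentKernel X Y hQ) hm hm
    (fun β => Real.abs_cos_le_one _) (fun β => Real.abs_cos_le_one _)]
  simp_rw [kernelMean_coefKernel_cos hQ, ← pow_two, mul_pow]
  rw [integral_const_mul, integral_cos_sq_eq_half (by fun_prop), ← Real.exp_nat_mul]
  simp_rw [← mul_assoc]
  rw [integral_latentMarginal_cos hQ]
  congr 2
  · push_cast; ring
  · congr 2; ring

end Trig

/-! ### The lower bound on the rate -/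

section Rate

variable {p : ℕ} {X : Matrix (Fin 1) (Fin p) ℝ} {Q : Matrix (Fin p) (Fin p) ℝ}

instance isMarkovKernel_acKernel {n : ℕ} (X : Matrix (Fin n) (Fin p) ℝ) (Y : Fin n → Bool)
    (Q : Matrix (Fin p) (Fin p) ℝ) (v : Fin p → ℝ) : IsMarkovKernel (acKernel X Y Q v) := by
  unfold acKernel; infer_instance

theorem acL2Rate_le_one (hQ : Q.PosDef) (Y : Fin 1 → Bool) : acL2Rate X Y Q 0 ≤ 1 := by
  have := isProbabilityMeasure_posterior X Y hQ
  exact l2Rate_le_one _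

/-- The frequency `r = √(1-ψ)` cancels the factor `(1-ψ)⁻¹` in the stationary moments. With `q`,
`w`, `b` as set in the proof, the variance is `(1+b²)/2 - b` and the lag-one covariance is `q(1+w)/2
- b`. -/
theorem one_sub_le_acL2Rate (hQ : Q.PosDef) (Y : Fin 1 → Bool) (hψ : 1 / 2 ≤ psi X Q) :
    1 - 9 * (1 - psi X Q) ≤ acL2Rate X Y Q 0 := by
  have := isProbabilityMeasure_posterior X Y hQ
  have := isProbabilityMeasure_latentMarginal X Y hQ
  have hc : 0 < 1 - psi X Q := sub_pos.2 (psi_lt_one X hQ)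
  refine le_l2Rate _ fun ρ hρ0 hρ => ?_
  have key := covariance_kernelMean_le_rate_mul (K := acKernel X Y Q 0)
    (kernelSymmetric_comp (posterior_compProd_latentKernel X Y hQ))
    (measurable_cos_mul_dotProduct X √(1 - psi X Q)) (fun β => Real.abs_cos_le_one _) hρ0 hρ
  rw [integral_cos_mul_kernelMean_acKernel hQ, integral_posterior_cos_sq hQ,
    integral_posterior_cos hQ, Real.sq_sqrt hc.le] at key
  set ψ := psi X Q
  have e1 : 2 * (1 - ψ) * ψ ^ 2 * (1 - ψ)⁻¹ = 2 * ψ ^ 2 := by field_simp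
  have e2 : 2 * (1 - ψ) * ψ * (1 - ψ)⁻¹ = ψ + ψ := by field_simp; ring
  have e3 : (1 - ψ) * ψ * (1 - ψ)⁻¹ / 2 = ψ / 2 := by field_simp
  have e4 : Real.exp (-(ψ / 2)) ^ 2 = Real.exp (-ψ) := by
    rw [← Real.exp_nat_mul]; congr 1; push_cast; ring
  have e5 : Real.exp (-(ψ + ψ)) = Real.exp (-ψ) ^ 2 := by
    rw [← Real.exp_nat_mul]; congr 1; push_cast; ring
  have e6 : Real.exp (-ψ) ^ 2 = Real.exp (-(2 * ψ ^ 2)) * Real.exp (-((1 - ψ) * ψ)) ^ 2 := by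
    rw [← Real.exp_nat_mul, ← Real.exp_nat_mul, ← Real.exp_add]; congr 1; push_cast; ring
  rw [e1, e2, e3, e4, e5] at key
  have hq1 : 1 - (1 - ψ) * ψ ≤ Real.exp (-((1 - ψ) * ψ)) := by
    have := Real.add_one_le_exp (-((1 - ψ) * ψ)); linarith
  have hq2 : Real.exp (-((1 - ψ) * ψ)) ≤ 1 := Real.exp_le_one_iff.2 (by nlinarith)
  have hq0 := Real.exp_pos (-((1 - ψ) * ψ))
  have hw0 := Real.exp_pos (-(2 * ψ ^ 2))
  have hb0 := Real.exp_pos (-ψ)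
  -- From `exp ψ ≥ 1 + ψ ≥ 3/2`. The variance `(1-b)²/2` is then at least `1/18`.
  have hb : Real.exp (-ψ) ≤ 2 / 3 := by
    have h1 := Real.add_one_le_exp ψ
    have h2 : Real.exp (-ψ) * Real.exp ψ = 1 := by rw [← Real.exp_add]; simp
    nlinarith
  set q := Real.exp (-((1 - ψ) * ψ))
  set w := Real.exp (-(2 * ψ ^ 2))
  set b := Real.exp (-ψ)
  have hD : 1 / 18 ≤ (1 + b ^ 2) / 2 - b := by nlinarith
  -- Since `b² = w q²`, the left side is `(1-q)/2 - wq(1-q)/2`, and `1 - q ≤ (1-ψ)ψ`. Dividing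
  -- `(1-ψ)/2` by the variance bound `1/18` produces the constant `9`.
  have hdiff : (1 + b ^ 2) / 2 - q * ((1 + w) / 2) ≤ (1 - ψ) / 2 := by
    have h1 : w * (q * (1 - q)) ≥ 0 := by
      have : 0 ≤ 1 - q := by linarith
      positivity
    rw [e6]
    nlinarith
  by_contra! hlt
  nlinarith

theorem abs_one_sub_acL2Rate_le (hQ : Q.PosDef) (Y : Fin 1 → Bool) (hψ : |psi X Q - 1| < 1 / 2) :
    |1 - acL2Rate X Y Q 0| ≤ 9 * |1 - psi X Q| := by
  have h1 := (abs_lt.1 hψ).1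
  rw [abs_of_nonneg (sub_nonneg.2 (acL2Rate_le_one hQ Y)),
    abs_of_pos (sub_pos.2 (psi_lt_one X hQ))]
  linarith [one_sub_le_acL2Rate (X := X) hQ Y (by linarith)]

theorem lambdaMax_fin_one (M : Matrix (Fin 1) (Fin 1) ℝ) : lambdaMax M = M 0 0 := by
  have h : spectrum ℝ M = {M 0 0} := by
    ext r
    rw [spectrum.mem_iff, Matrix.isUnit_iff_isUnit_det, Matrix.det_fin_one, isUnit_iff_ne_zero,
      not_not, Set.mem_singleton_iff]
    simp [Matrix.algebraMap_matrix_apply, sub_eq_zero]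
  rw [lambdaMax, h, csSup_singleton]

end Rate

end

theorem mainTheorem5 :
    (∃ C δ : ℝ, 0 < C ∧ 0 < δ ∧
      ∀ (p : ℕ) (X : Matrix (Fin 1) (Fin p) ℝ) (Y : Fin 1 → Bool)
        (Q : Matrix (Fin p) (Fin p) ℝ), Q.PosDef →
        |psi X Q - 1| < δ → |1 - acL2Rate X Y Q 0| ≤ C * |1 - psi X Q|) ∧
    (∀ (X : (p : ℕ) → Matrix (Fin 1) (Fin p) ℝ) (Y : Fin 1 → Bool)
      (Q : (p : ℕ) → Matrix (Fin p) (Fin p) ℝ),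
      (∀ p : ℕ, 1 ≤ p → (Q p).PosDef) →
      ¬ AssumptionB2 X Q →
      ¬ ∃ ρ : ℝ, ρ < 1 ∧ ∀ p : ℕ, 1 ≤ p → acL2Rate (X p) Y (Q p) 0 ≤ ρ) := by
  refine ⟨⟨9, 1 / 2, by norm_num, by norm_num, fun p X Y Q hQ hψ =>
    abs_one_sub_acL2Rate_le hQ Y hψ⟩, fun X Y Q hQ hB => ?_⟩
  rintro ⟨ρ, hρ1, hρ⟩
  -- If `t` reaches this value then `1-ψ = 1/(1+t) < (1-ρ)/9`, so the rate exceeds `ρ`. The summand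
  -- `1` ensures `t ≥ 1`, that is `ψ ≥ 1/2`.
  refine hB ⟨9 / (1 - ρ) + 1, by have := sub_pos.2 hρ1; positivity, fun p hp => ?_⟩
  rw [lambdaMax_fin_one]
  by_contra! ht
  have hr : 0 < 1 - ρ := sub_pos.2 hρ1
  have h1 := one_sub_psi_mul (X p) (hQ p hp)
  have hc : 0 < 1 - psi (X p) (Q p) := sub_pos.2 (psi_lt_one (X p) (hQ p hp))
  set t := (X p * (Q p)⁻¹ * (X p)ᵀ) 0 0
  have h9 : 0 < 9 / (1 - ρ) := by positivity
  have hmul : 9 / (1 - ρ) * (1 - ρ) = 9 := div_mul_cancel₀ _ hr.ne'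
  have h2 := one_sub_le_acL2Rate (X := X p) (hQ p hp) Y (by nlinarith)
  have h3 := hρ p hp
  nlinarith
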